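/- Let $Q$ be any quadratic form on $\mathbb R^d$ (possibly indefinite or degenerate). Put $\widehat Q(x,a,b)=Q(x)-ab$ on $\mathbb R^{d}\times\mathbb R\times\mathbb R$, and let $\partial\mathbb X\subset\mathbb{RP}^{d+1}$ be the set of $\widehat Q$-null lines. Embed $\mathbb R^d\hookrightarrow\partial\mathbb X$ by $x\mapsto[x:Q(x):1]$ and let $\infty=[0:1:0]$. The light cone $\mathscr L(p)$ of $p\in\partial\mathbb X$ is the set of points of $\partial\mathbb X$ that are $\widehat Q$-orthogonal to $p$. A $Q$-sphere $\{Q=\varphi+D\}$ ($\varphi$ a linear functional, $D\in\mathbb R$) is regarded in $\partial\mathbb X$ as the section of $\partial\mathbb X$ by the projective hyperplane $\{[y:a:b] : a=\varphi(y)+Db\}$. Let $X\subset\mathbb R^d$ be a finite set in spacelike position ($Q(x-y)>0$ for all distinct $x,y\in X$) and in general linear position (any at most $d+1$ points of $X$ are affinely independent). A $Q$-sphere $S=\{Q=\varphi+D\}$ such that $X\cap S$ has the same affine hull as $X$ is called *empty* if $Q\ge\varphi+D$ on $X$, and *full* if $Q\le\varphi+D$ on $X$. For a finite set $Y\subset\mathbb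 R^d$, the cells of $\mathrm{Del}_Q(Y)$ (of all dimensions) are the projections to $\mathbb R^d$ of the bottom faces of the convex hull $\mathscr C\subset\mathbb R^{d+1}$ of $\{(y,Q(y)) : y\in Y\}$, that is, of the non-empty faces cut out by a supporting hyperplane that has an inward normal with positive last coordinate. Let $f\in\mathrm{PO}(\widehat Q)$ be a transformation of $\mathbb{RP}^{d+1}$ induced by a linear isomorphism preserving $\widehat Q$. Suppose that $f^{-1}(\infty)$ lies in the same connected component as $\infty$ of the complement in $\partial\mathbb X$ of the union of all empty and full $Q$-spheres of $X$ and of the light cones $\mathscr L(x)$, $x\in X$. Then: 1. $f(X)\subset\mathbb R^d$, and $f(X)$ is in spacelike position. 2. $f(\mathrm{Del}_Q(X))$ straightens to $\mathrm{Del}_Q(f(X))$ in $\partial\mathbb X$: the sets $\mathrm{CH}(f(X\cap\Delta))$, for $\Delta$ a cell of $\mathrm{Del}_Q(X)$, are exactly the cells of $\mathrm{Del}_Q(f(X))$, and there is a continuous family of injective maps $H_t:\mathrm{CH}(X)\to\partial\mathbb X$, $t\in[0,1]$, with $H_0=f|_{\mathrm{CH}(X)}$, with $H_t(x)=f(x)$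 for all $t$ and all $x\in X$, and with $H_1(\Delta)=\mathrm{CH}(f(X\cap\Delta))$ for every cell $\Delta$ of $\mathrm{Del}_Q(X)$. 3. If moreover $f(\mathrm{CH}(X))\subset\mathbb R^d$, then such a family exists with all $H_t$ taking values in $\mathbb R^d$. -/

import Mathlib

open Set

noncomputable section

/-- The ambient space `ℝ^{d+2} = ℝ^d × ℝ × ℝ`. -/
abbrev Hat (d : ℕ) : Type := (Fin d → ℝ) × ℝ × ℝ

/-- `Q̂(x, a, b) = Q(x) - a b` on `ℝ^{d+2}`. -/
def Qhat {d : ℕ} (Q : QuadraticForm ℝ (Fin d → ℝ)) : QuadraticForm ℝ (Hat d) :=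
  Q.comp (LinearMap.fst ℝ (Fin d → ℝ) (ℝ × ℝ)) -
    QuadraticMap.linMulLin
      ((LinearMap.fst ℝ ℝ ℝ).comp (LinearMap.snd ℝ (Fin d → ℝ) (ℝ × ℝ)))
      ((LinearMap.snd ℝ ℝ ℝ).comp (LinearMap.snd ℝ (Fin d → ℝ) (ℝ × ℝ)))

theorem Qhat_apply {d : ℕ} (Q : QuadraticForm ℝ (Fin d → ℝ)) (v : Hat d) :
    Qhat Q v = Q v.1 - v.2.1 * v.2.2 := rfl

/-- The projective space `ℝℙ^{d+1}`. -/
abbrev RP (d : ℕ) : Type := Projectivization ℝ (Hat d)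

/-- The quotient topology on `ℝℙ^{d+1}`. -/
instance instTopologicalSpaceRP (d : ℕ) : TopologicalSpace (RP d) :=
  TopologicalSpace.coinduced (Projectivization.mk' ℝ : {v : Hat d // v ≠ 0} → RP d) inferInstance

/-- The conformal compactification `∂𝕏` of `(ℝ^d, Q)`: the lines that are null for `Q̂`, that is,
the boundary of the set `𝕏` of negative lines. The condition does not depend on the
representative of the line. -/
def bdX {d : ℕ} (Q : QuadraticForm ℝ (Fin d → ℝ)) : Set (RP d) :=
  {p | Qhat Q p.rep = 0}

/-- The point `∞ = [0 : 1 : 0]` of `∂𝕏`. -/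
def inftyPt (d : ℕ) : RP d :=
  Projectivization.mk ℝ ((0, 1, 0) : Hat d) (fun h => one_ne_zero (congrArg (fun v => v.2.1) h))

/-- The standard chart `ℝ^d → ∂𝕏`, `x ↦ [x : Q x : 1]`. -/
def chart {d : ℕ} (Q : QuadraticForm ℝ (Fin d → ℝ)) (x : Fin d → ℝ) : RP d :=
  Projectivization.mk ℝ ((x, Q x, 1) : Hat d) (fun h => one_ne_zero (congrArg (fun v => v.2.2) h))

/-- The light cone `ℒ(p) ⊆ ∂𝕏` of `p`: the points of `∂𝕏` that are `Q̂`-orthogonal to `p`. -/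
def lightCone {d : ℕ} (Q : QuadraticForm ℝ (Fin d → ℝ)) (p : RP d) : Set (RP d) :=
  {q ∈ bdX Q | QuadraticMap.polar (Qhat Q) p.rep q.rep = 0}

/-- The `Q`-sphere `Q(x) = φ(x) + D` as a subset of `∂𝕏`: the section of `∂𝕏` by the projective
hyperplane of all `[y : a : b]` with `a = φ(y) + D b`. -/
def sphereAt {d : ℕ} (Q : QuadraticForm ℝ (Fin d → ℝ)) (φ : (Fin d → ℝ) →ₗ[ℝ] ℝ) (D : ℝ) :
    Set (RP d) :=
  {q ∈ bdX Q | q.rep.2.1 = φ q.rep.1 + D * q.rep.2.2}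

/-- The transformation of `ℝℙ^{d+1}` induced by an element of `O(Q̂)`; these transformations make
up the group `PO(Q̂)`. -/
def mobius {d : ℕ} {Q : QuadraticForm ℝ (Fin d → ℝ)}
    (f : QuadraticMap.IsometryEquiv (Qhat Q) (Qhat Q)) : RP d → RP d :=
  Projectivization.map (f.toLinearEquiv : Hat d →ₗ[ℝ] Hat d) f.toLinearEquiv.injective

/-- Spacelike position: distinct points have positive `Q`-displacement. -/
def SpacelikePosition {d : ℕ} (Q : QuadraticForm ℝ (Fin d → ℝ)) (X : Set (Fin d → ℝ)) : Prop :=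
  ∀ x ∈ X, ∀ y ∈ X, x ≠ y → 0 < Q (x - y)

/-- General linear position: any at most `d + 1` points of `X` are affinely independent. If `X`
has at least `d + 1` points, this says that no `d + 1` of them lie in an affine hyperplane. -/
def GeneralLinearPosition {d : ℕ} (X : Set (Fin d → ℝ)) : Prop :=
  ∀ Y ⊆ X, Y.encard ≤ d + 1 → AffineIndependent ℝ (Subtype.val : Y → (Fin d → ℝ))

/-- The convex hull `𝒞` in `ℝ^{d+1}` of the lifts `(x, Q x)` of the points of `X` to the graph
of `Q`. -/
def liftedHull {d : ℕ} (Q : QuadraticForm ℝ (Fin d → ℝ)) (X : Set (Fin d → ℝ)) :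
    Set ((Fin d → ℝ) × ℝ) :=
  convexHull ℝ ((fun x => (x, Q x)) '' X)

/-- The bottom faces (of all dimensions) of `𝒞`: the non-empty faces of `𝒞` cut out by a
supporting hyperplane with an inward normal `n` whose last component is positive. -/
def IsBottomFace {d : ℕ} (Q : QuadraticForm ℝ (Fin d → ℝ)) (X : Set (Fin d → ℝ))
    (F : Set ((Fin d → ℝ) × ℝ)) : Prop :=
  F.Nonempty ∧ ∃ n : ((Fin d → ℝ) × ℝ) →ₗ[ℝ] ℝ, 0 < n (0, 1) ∧
    F = {z ∈ liftedHull Q X | ∀ w ∈ liftedHull Q X, n z ≤ n w}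

/-- The `Q`-Delaunay decomposition `Del_Q(X)`, as the collection of its cells of all dimensions:
the projections to `ℝ^d` of the bottom faces of `𝒞`. -/
def Del {d : ℕ} (Q : QuadraticForm ℝ (Fin d → ℝ)) (X : Set (Fin d → ℝ)) :
    Set (Set (Fin d → ℝ)) :=
  {Δ | ∃ F, IsBottomFace Q X F ∧ Δ = Prod.fst '' F}

/-- The `Q`-sphere `Q(x) = φ(x) + D` is circumscribed about a top-dimensional polytope with
vertices in `X`: the points of `X` on it span the affine hull of `X`. -/
def Circumscribed {d : ℕ} (Q : QuadraticForm ℝ (Fin d → ℝ)) (X : Set (Fin d → ℝ))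
    (φ : (Fin d → ℝ) →ₗ[ℝ] ℝ) (D : ℝ) : Prop :=
  affineSpan ℝ {x ∈ X | Q x = φ x + D} = affineSpan ℝ X

/-- An empty `Q`-sphere of `X`: the boundary of a `Q`-ball `Q(x) ≤ φ(x) + D` that is circumscribed
about a top-dimensional cell and has no point of `X` in its interior. -/
def IsEmptySphere {d : ℕ} (Q : QuadraticForm ℝ (Fin d → ℝ)) (X : Set (Fin d → ℝ))
    (φ : (Fin d → ℝ) →ₗ[ℝ] ℝ) (D : ℝ) : Prop :=
  Circumscribed Q X φ D ∧ ∀ x ∈ X, ¬ Q x < φ x + D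

/-- A full `Q`-sphere of `X`: the boundary of a `Q`-ball `Q(x) ≤ φ(x) + D` that is circumscribed
about a top-dimensional cell and contains all points of `X`. -/
def IsFullSphere {d : ℕ} (Q : QuadraticForm ℝ (Fin d → ℝ)) (X : Set (Fin d → ℝ))
    (φ : (Fin d → ℝ) →ₗ[ℝ] ℝ) (D : ℝ) : Prop :=
  Circumscribed Q X φ D ∧ ∀ x ∈ X, Q x ≤ φ x + D

/-- The complement in `∂𝕏` of the union of all empty and full `Q`-spheres of `X` and of the light
cones of the points of `X`. -/
def admissible {d : ℕ} (Q : QuadraticForm ℝ (Fin d → ℝ)) (X : Set (Fin d → ℝ)) : Set (RP d) :=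
  bdX Q \ ({q | ∃ φ D, (IsEmptySphere Q X φ D ∨ IsFullSphere Q X φ D) ∧ q ∈ sphereAt Q φ D} ∪
    ⋃ x ∈ X, lightCone Q (chart Q x))

/-- The part of `f(Y)` in `ℝ^d`, for `Y ⊆ ℝ^d`. -/
def imagePts {d : ℕ} {Q : QuadraticForm ℝ (Fin d → ℝ)}
    (f : QuadraticMap.IsometryEquiv (Qhat Q) (Qhat Q)) (Y : Set (Fin d → ℝ)) :
    Set (Fin d → ℝ) :=
  {z | ∃ y ∈ Y, mobius f (chart Q y) = chart Q z}

/-- `f(Del_Q(X))` straightens to `Del_Q(f(X))` within `M ⊆ ∂𝕏`. First, the straightened images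
of the cells of `Del_Q(X)` (a cell `Δ` has vertex set `X ∩ Δ`, and its straightened image is the
convex hull of the images of its vertices) are exactly the cells of `Del_Q(f(X))`. Second, there
is an isotopy in `M`, fixed on the vertices, from the restriction of `f` to the union `CH(X)` of
the cells of `Del_Q(X)` to an embedding that takes every cell onto its straightened image. -/
def StraightensIn {d : ℕ} (Q : QuadraticForm ℝ (Fin d → ℝ))
    (f : QuadraticMap.IsometryEquiv (Qhat Q) (Qhat Q)) (X : Set (Fin d → ℝ))
    (M : Set (RP d)) : Prop :=
  {Δ' | ∃ Δ ∈ Del Q X, Δ' = convexHull ℝ (imagePts f (X ∩ Δ))} = Del Q (imagePts f X) ∧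
  ∃ H : ℝ → (Fin d → ℝ) → RP d,
    ContinuousOn (fun p : ℝ × (Fin d → ℝ) => H p.1 p.2) (Icc 0 1 ×ˢ convexHull ℝ X) ∧
    (∀ t ∈ Icc (0 : ℝ) 1, MapsTo (H t) (convexHull ℝ X) M ∧ InjOn (H t) (convexHull ℝ X)) ∧
    (∀ y ∈ convexHull ℝ X, H 0 y = mobius f (chart Q y)) ∧
    (∀ t ∈ Icc (0 : ℝ) 1, ∀ x ∈ X, H t x = mobius f (chart Q x)) ∧
    ∀ Δ ∈ Del Q X, H 1 '' Δ = chart Q '' convexHull ℝ (imagePts f (X ∩ Δ))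

end

/-! Everything is linearized in `Hat d`. A point `x` becomes the null vector `nullLift Q x`, and a
`Q`-sphere becomes the kernel of a functional normalized to 1 at `inftyVec d`. Delaunay cells are
the hulls of the non-empty zero sets of functionals that are nonnegative on the lifts and positive
at `inftyVec d` (`mem_Del_iff`). Pulled back through a multiple `g` of `f`, the cells of the image
are described in the same way, with `inftyVec d` replaced by a vector `p` over `f⁻¹(∞)`. So the two
decompositions agree once the same faces of the cone over the lifts are seen from both vectors.

Every functional to be compared can be pushed to a facet of the dual description
(`exists_facet_functional`). General linear position excludes facets whose functional vanishes at
`∞`, so the normalized facet functionals define empty or full spheres, and there are finitely many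
(`exists_sphere_families`). If all lifts lie on one sphere, that sphere alone replaces the facets.
Connectedness of the component containing `∞` and `f⁻¹(∞)` yields a path `γ` of null vectors from
`inftyVec d` to `p` (`exists_null_path`) along which these functionals and minus the pairings with
the lifts never vanish. They equal 1 at the start, so they stay positive. The pairings make the last
coordinate of `g (nullLift Q x)` positive, which gives finiteness and spacelike position of the
image; the spheres give the equality of cells (`straightened_cells`).

For the isotopy, each point of the lower boundary of the hull is moved parallel to `γ t` onto the
null cone, and `g` is applied. At time 0 the direction is vertical and the result is the graph of
`Q`, hence `f`. At time 1 the direction is `p`, which `g` makes vertical, hence the straightened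
picture. The map is injective because the empty-sphere functionals that support the lower boundary
are positive on every `γ t`. When `f` is finite on `CH(X)`, the straight vertical interpolation from
the graph of `Q` to the lower boundary, followed by `g` and projection to `ℝ^d`, stays in the chart
(`exists_isotopy_chart`). -/

noncomputable section

open Filter Topology

/-! ### Facet functionals, affine interpolation and projective images of hulls. -/

/-- A functional that is nonnegative on a spanning set `S` and positive at `v` can be moved, within
these functionals and without increasing its value at a point `w` of the bidual cone of `S`, to one
whose zeros in `S` determine it up to scaling. -/
theorem exists_facet_functional {V : Type*} [AddCommGroup V] [Module ℝ V] {S : Set V}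
    (hS : S.Finite) (hspan : ∀ m : V →ₗ[ℝ] ℝ, (∀ x ∈ S, m x = 0) → m = 0) {v w : V}
    (hw : ∀ m : V →ₗ[ℝ] ℝ, (∀ x ∈ S, 0 ≤ m x) → 0 ≤ m w)
    (l : V →ₗ[ℝ] ℝ) (hl : ∀ x ∈ S, 0 ≤ l x) (hv : 0 < l v) :
    ∃ l' : V →ₗ[ℝ] ℝ, (∀ x ∈ S, 0 ≤ l' x) ∧ l' v = l v ∧ l' w ≤ l w ∧
      (∀ x ∈ S, l x = 0 → l' x = 0) ∧
      ∀ m : V →ₗ[ℝ] ℝ, (∀ x ∈ S, l' x = 0 → m x = 0) → ∃ c : ℝ, m = c • l' := by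
  induction hn : {x ∈ S | l x ≠ 0}.ncard using Nat.strong_induction_on generalizing l with
  | _ n ih =>
    by_cases hfacet : ∀ m : V →ₗ[ℝ] ℝ, (∀ x ∈ S, l x = 0 → m x = 0) → ∃ c : ℝ, m = c • l
    · exact ⟨l, hl, rfl, le_rfl, fun _ _ h => h, hfacet⟩
    push Not at hfacet
    obtain ⟨m₀, hm₀, hne₀⟩ := hfacet
    have h1 : ∃ m : V →ₗ[ℝ] ℝ, (∀ x ∈ S, l x = 0 → m x = 0) ∧ m v = 0 ∧ m ≠ 0 := by
      refine ⟨m₀ - (m₀ v / l v) • l, fun x hx h => by simp [hm₀ x hx h, h], ?_, ?_⟩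
      · simp [hv.ne']
      · intro h
        exact hne₀ _ (sub_eq_zero.1 h)
    -- The sign of `m` is at our disposal. If `m` takes both signs on `S`, choose it by the value at
    -- `w`; if `m` has one sign on `S`, the bidual hypothesis on `w` makes the two requirements
    -- compatible.
    have h2 : ∃ m : V →ₗ[ℝ] ℝ, (∀ x ∈ S, l x = 0 → m x = 0) ∧ m v = 0 ∧ m w ≤ 0 ∧
        ∃ x ∈ S, m x < 0 := by
      obtain ⟨m, hm, hmv, hm0⟩ := h1
      have hex : ∃ x ∈ S, m x ≠ 0 := by
        by_contra! h
        exact hm0 (hspan m h)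
      by_cases hneg : ∃ x ∈ S, m x < 0
      · by_cases hpos : ∃ x ∈ S, 0 < m x
        · rcases le_total (m w) 0 with h | h
          · exact ⟨m, hm, hmv, h, hneg⟩
          · obtain ⟨x, hx, hxp⟩ := hpos
            exact ⟨-m, fun x hx h => by simp [hm x hx h], by simp [hmv], by simpa using h,
              x, hx, by simpa using hxp⟩
        · push Not at hpos
          have := hw (-m) (fun x hx => by simpa using hpos x hx)
          exact ⟨m, hm, hmv, by simpa using this, hneg⟩
      · push Not at hneg
        obtain ⟨x, hx, hx0⟩ := hex
        exact ⟨-m, fun x hx h => by simp [hm x hx h], by simp [hmv], by simpa using hw m hneg,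
          x, hx, by simpa using lt_of_le_of_ne (hneg x hx) hx0.symm⟩
    obtain ⟨m, hm, hmv, hmw, x₁, hx₁, hx₁neg⟩ := h2
    have hfin : {x ∈ S | m x < 0}.Finite := hS.subset fun x hx => hx.1
    obtain ⟨x₀, ⟨hx₀, hx₀neg⟩, hmin⟩ :=
      Set.exists_min_image _ (fun x => l x / (-m x)) hfin ⟨x₁, hx₁, hx₁neg⟩
    -- The longest step in direction `m` that stays nonnegative on `S`; it creates a new zero at
    -- `x₀`, and the induction is on the number of non-zeros.
    set t : ℝ := l x₀ / (-m x₀) with ht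
    have ht0 : 0 ≤ t := div_nonneg (hl _ hx₀) (by linarith)
    have hnn : ∀ x ∈ S, 0 ≤ (l + t • m) x := by
      intro x hx
      simp only [LinearMap.add_apply, LinearMap.smul_apply, smul_eq_mul]
      rcases lt_or_ge (m x) 0 with h | h
      · have := hmin x ⟨hx, h⟩
        have h' : t ≤ l x / (-m x) := this
        rw [le_div_iff₀ (by linarith)] at h'
        linarith
      · have := hl x hx
        positivity
    have hzero : (l + t • m) x₀ = 0 := by
      simp only [LinearMap.add_apply, LinearMap.smul_apply, smul_eq_mul, ht]
      field_simp [hx₀neg.ne]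
      ring
    have hlt : {x ∈ S | (l + t • m) x ≠ 0}.ncard < n := by
      rw [← hn]
      apply Set.ncard_lt_ncard _ (hS.subset fun x hx => hx.1)
      refine ⟨fun x hx => ⟨hx.1, fun h => hx.2 ?_⟩, fun hsub => ?_⟩
      · simp [h, hm x hx.1 h]
      · exact (hsub (show x₀ ∈ {x ∈ S | l x ≠ 0} from
          ⟨hx₀, fun h => hx₀neg.ne (hm x₀ hx₀ h)⟩)).2 hzero
    obtain ⟨l', h1, h2, h3, h4, h5⟩ := ih _ hlt (l + t • m) hnn (by simpa [hmv] using hv) rfl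
    refine ⟨l', h1, by simpa [hmv] using h2, h3.trans ?_, fun x hx h => h4 x hx ?_, h5⟩
    · simp only [LinearMap.add_apply, LinearMap.smul_apply, smul_eq_mul]
      nlinarith
    · simp [h, hm x hx h]

/-- Affine interpolation on an affinely independent set. -/
theorem exists_affine_interpolation {d : ℕ} {Z : Set (Fin d → ℝ)}
    (hZ : AffineIndependent ℝ (Subtype.val : Z → (Fin d → ℝ))) (g : (Fin d → ℝ) → ℝ) :
    ∃ (φ : (Fin d → ℝ) →ₗ[ℝ] ℝ) (D : ℝ), ∀ x ∈ Z, φ x + D = g x := by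
  -- Homogenizing by a coordinate 1 turns affine into linear independence, so prescribed values
  -- extend linearly.
  have hli : LinearIndependent ℝ (fun x : Z => ((x.1, (1 : ℝ)) : (Fin d → ℝ) × ℝ)) := by
    rw [linearIndependent_iff']
    intro s w hw
    rw [affineIndependent_iff] at hZ
    refine hZ s w ?_ ?_
    · simpa [Prod.snd_sum] using congrArg Prod.snd hw
    · simpa [Prod.fst_sum] using congrArg Prod.fst hw
  obtain ⟨F, hF⟩ := LinearMap.exists_extend
    ((Module.Basis.span hli).constr ℝ (fun x : Z => g x.1))
  refine ⟨F.comp (LinearMap.inl ℝ _ _), F (0, 1), fun x hx => ?_⟩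
  have h1 := LinearMap.congr_fun hF (Module.Basis.span hli ⟨x, hx⟩)
  rw [Module.Basis.constr_basis] at h1
  simp only [LinearMap.comp_apply, Submodule.subtype_apply, Module.Basis.span_apply] at h1
  rw [← h1, LinearMap.comp_apply, ← map_add]
  simp

/-- The image of a convex hull under a projective map `v ↦ (c v)⁻¹ g v`, with `c` positive on the
generating set. -/
theorem image_convexHull_projective {V W : Type*} [AddCommGroup V] [Module ℝ V] [AddCommGroup W]
    [Module ℝ W] (g : V →ₗ[ℝ] W) (c : V →ₗ[ℝ] ℝ) {S : Set V} (hc : ∀ v ∈ S, 0 < c v) :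
    (fun v => (c v)⁻¹ • g v) '' convexHull ℝ S = convexHull ℝ ((fun v => (c v)⁻¹ • g v) '' S) := by
  have hpos : ∀ v ∈ convexHull ℝ S, 0 < c v := fun v hv =>
    convexHull_min hc (convex_halfSpace_gt c.isLinear 0) hv
  have key : ∀ u v : V, 0 < c u → 0 < c v → ∀ a b : ℝ, 0 ≤ a → 0 ≤ b → a + b = 1 →
      (c (a • u + b • v))⁻¹ • g (a • u + b • v) =
        (a * c u / c (a • u + b • v)) • ((c u)⁻¹ • g u) +
        (b * c v / c (a • u + b • v)) • ((c v)⁻¹ • g v) := by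
    intro u v hu hv a b _ _ _
    rw [smul_smul, smul_smul, map_add g, map_smul, map_smul, smul_add, smul_smul, smul_smul]
    congr 2 <;> field_simp
  have cpos : ∀ u v : V, 0 < c u → 0 < c v → ∀ a b : ℝ, 0 ≤ a → 0 ≤ b → a + b = 1 →
      0 < c (a • u + b • v) := by
    intro u v hu hv a b ha hb hab
    exact (convex_halfSpace_gt c.isLinear 0) hu hv ha hb hab
  apply subset_antisymm
  · rintro _ ⟨v, hv, rfl⟩
    suffices v ∈ {v | 0 < c v ∧ (c v)⁻¹ • g v ∈ convexHull ℝ ((fun v => (c v)⁻¹ • g v) '' S)} from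
      this.2
    refine convexHull_min (fun u hu => And.intro (hc u hu)
      (subset_convexHull ℝ _ (mem_image_of_mem _ hu))) ?_ hv
    rintro u ⟨hu, hu'⟩ v ⟨hv, hv'⟩ a b ha hb hab
    have hp := cpos u v hu hv a b ha hb hab
    refine ⟨hp, ?_⟩
    rw [key u v hu hv a b ha hb hab]
    refine (convex_convexHull ℝ _) hu' hv' (by positivity) (by positivity) ?_
    rw [← add_div, div_eq_one_iff_eq hp.ne']
    simp
  · refine convexHull_min (image_mono (subset_convexHull ℝ S)) ?_
    rintro _ ⟨u, hu, rfl⟩ _ ⟨v, hv, rfl⟩ a b ha hb hab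
    have hcu := hpos u hu
    have hcv := hpos v hv
    -- Undoing the reweighting by `c`: dividing the weights by `c u` and `c v` and renormalizing by
    -- `s` gives the preimage of the convex combination.
    set s : ℝ := a / c u + b / c v with hs
    have hs0 : 0 < s := by
      rcases ha.eq_or_lt with h | h
      · have : 0 < b := by linarith
        rw [hs]; positivity
      · rw [hs]; positivity
    refine ⟨(a / c u / s) • u + (b / c v / s) • v, (convex_convexHull ℝ S) hu hv (by positivity)
      (by positivity) (by rw [← add_div, div_self hs0.ne']), ?_⟩
    have hcs : c ((a / c u / s) • u + (b / c v / s) • v) = s⁻¹ := by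
      rw [map_add, map_smul, map_smul, smul_eq_mul, smul_eq_mul]
      field_simp
      exact hab
    simp only
    rw [hcs, inv_inv, map_add, map_smul, map_smul, smul_add, smul_smul, smul_smul, smul_smul,
      smul_smul]
    congr 2 <;> field_simp

/-! ### Paths in the null cone avoiding finitely many hyperplanes. -/

/-- The polar form of `Q̂`. -/
abbrev polarHat {d : ℕ} (Q : QuadraticForm ℝ (Fin d → ℝ)) : LinearMap.BilinForm ℝ (Hat d) :=
  (Qhat Q).polarBilin

theorem Qhat_add {d : ℕ} (Q : QuadraticForm ℝ (Fin d → ℝ)) (u v : Hat d) :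
    Qhat Q (u + v) = Qhat Q u + Qhat Q v + polarHat Q u v :=
  QuadraticMap.map_add _ u v

theorem Qhat_smul {d : ℕ} (Q : QuadraticForm ℝ (Fin d → ℝ)) (a : ℝ) (v : Hat d) :
    Qhat Q (a • v) = a ^ 2 * Qhat Q v := by
  rw [QuadraticMap.map_smul, smul_eq_mul, sq]

theorem polarHat_self {d : ℕ} (Q : QuadraticForm ℝ (Fin d → ℝ)) (v : Hat d) :
    polarHat Q v v = 2 * Qhat Q v := by
  simp [QuadraticMap.polar_self]

theorem polarHat_comm {d : ℕ} (Q : QuadraticForm ℝ (Fin d → ℝ)) (u v : Hat d) :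
    polarHat Q u v = polarHat Q v u := by
  simp [QuadraticMap.polar_comm]

/-- The null vectors of `Q̂` at which no functional of `L` vanishes. -/
def nullOff {d : ℕ} (Q : QuadraticForm ℝ (Fin d → ℝ)) (L : Set (Hat d →ₗ[ℝ] ℝ)) : Set (Hat d) :=
  {v | Qhat Q v = 0 ∧ ∀ l ∈ L, l v ≠ 0}

theorem smul_mem_nullOff {d : ℕ} {Q : QuadraticForm ℝ (Fin d → ℝ)} {L : Set (Hat d →ₗ[ℝ] ℝ)}
    {v : Hat d} (hv : v ∈ nullOff Q L) {a : ℝ} (ha : a ≠ 0) : a • v ∈ nullOff Q L :=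
  ⟨by rw [Qhat_smul, hv.1, mul_zero], fun l hl => by simpa [ha] using hv.2 l hl⟩

theorem JoinedIn.smul_nullOff {d : ℕ} {Q : QuadraticForm ℝ (Fin d → ℝ)}
    {L : Set (Hat d →ₗ[ℝ] ℝ)} {u v : Hat d} (h : JoinedIn (nullOff Q L) u v) {a : ℝ}
    (ha : a ≠ 0) : JoinedIn (nullOff Q L) (a • u) (a • v) := by
  obtain ⟨γ, hγ⟩ := h
  exact ⟨γ.map (continuous_const_smul a), fun t => smul_mem_nullOff (hγ t) ha⟩

/-- Arcs in the null cone from (multiples of) a null vector `v` to all nearby null vectors. -/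
theorem exists_null_arcs {d : ℕ} (Q : QuadraticForm ℝ (Fin d → ℝ)) {v : Hat d}
    (hv : Qhat Q v = 0) :
    ∃ (G : Hat d × ℝ → Hat d) (α : Hat d → ℝ), Continuous G ∧ Continuous α ∧ α v = 1 ∧
      (∀ τ, G (v, τ) = v) ∧ (∀ u, G (u, 1) = u) ∧ (∀ u, G (u, 0) = α u • v) ∧
      ∀ u τ, Qhat Q u = 0 → Qhat Q (G (u, τ)) = 0 := by
  by_cases hsing : ∀ u, polarHat Q v u = 0
  · refine ⟨fun p => (1 - p.2) • v + p.2 • p.1, fun _ => 1, by fun_prop, by fun_prop, rfl,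
      fun τ => ?_, fun u => by simp, fun u => by simp, fun u τ hu => ?_⟩
    · simp [← add_smul]
    · simp only [Qhat_add, Qhat_smul, hu, hv, map_smul, LinearMap.smul_apply, hsing]
      simp
  · push Not at hsing
    obtain ⟨r₀, hr₀⟩ := hsing
    -- A hyperbolic partner of `v`, obtained by correcting `r₀` along `v` and rescaling.
    obtain ⟨r, hr, hvr⟩ : ∃ r, Qhat Q r = 0 ∧ polarHat Q v r = 1 := by
      refine ⟨(polarHat Q v r₀)⁻¹ • (r₀ + (-(Qhat Q r₀) / polarHat Q v r₀) • v), ?_, ?_⟩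
      · rw [Qhat_smul, Qhat_add, Qhat_smul, hv, map_smul, smul_eq_mul, polarHat_comm Q r₀ v,
          div_mul_cancel₀ _ hr₀]
        ring
      · rw [map_smul, map_add, map_smul, polarHat_self, hv]
        simp only [smul_eq_mul, mul_zero, add_zero]
        exact inv_mul_cancel₀ hr₀
    have hc : ∀ x : Hat d, Continuous fun u => polarHat Q u x := fun x =>
      LinearMap.continuous_of_finiteDimensional ((polarHat Q).flip x)
    set α : Hat d → ℝ := fun u => polarHat Q u r with hα
    set s : Hat d → ℝ := fun u => polarHat Q u v with hs
    have hαc : Continuous α := hc r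
    have hsc : Continuous s := hc v
    -- Write `u = α v + e + s r` with `e` orthogonal to `v` and `r`. Scaling `e` by `τ` and the
    -- `r`-part by `τ ^ 2` multiplies the form by `τ ^ 2`, so the arc remains null.
    refine ⟨fun p => α p.1 • v + p.2 • (p.1 - α p.1 • v - s p.1 • r) + (p.2 ^ 2 * s p.1) • r, α,
      by fun_prop, hαc, hvr, fun τ => ?_, fun u => ?_, fun u => by simp, fun u τ hu => ?_⟩
    · have h1 : α v = 1 := hvr
      have h2 : s v = 0 := by simp only [hs]; rw [polarHat_self, hv, mul_zero]
      simp [h1, h2]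
    · simp only [one_smul, one_pow, one_mul]
      abel
    · obtain ⟨e, he⟩ : ∃ e, e = u - α u • v - s u • r := ⟨_, rfl⟩
      have hrv : polarHat Q r v = 1 := by rw [polarHat_comm, hvr]
      have hev : polarHat Q v e = 0 := by
        rw [he, map_sub, map_sub, map_smul, map_smul, polarHat_self, hv, hvr, polarHat_comm]
        simp [hs]
      have her : polarHat Q r e = 0 := by
        rw [he, map_sub, map_sub, map_smul, map_smul, polarHat_self, hr, hrv, polarHat_comm]
        simp [hα]
      have hu' : u = α u • v + e + s u • r := by rw [he]; abel
      have hQe : Qhat Q e + α u * s u = 0 := by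
        rw [← hu, hu', Qhat_add, Qhat_add, Qhat_smul, Qhat_smul, hv, hr, ← hu', map_smul, map_smul,
          map_add, map_smul, LinearMap.add_apply, LinearMap.smul_apply, LinearMap.smul_apply,
          polarHat_comm Q e r, her, hev, hvr]
        simp only [smul_eq_mul]
        ring
      change Qhat Q (α u • v + τ • (u - α u • v - s u • r) + (τ ^ 2 * s u) • r) = 0
      rw [← he, Qhat_add, Qhat_add, Qhat_smul, Qhat_smul, Qhat_smul, hv, hr]
      simp only [map_smul, map_add, LinearMap.add_apply, LinearMap.smul_apply,
          polarHat_comm Q e r, her, hev, hvr, smul_eq_mul]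
      linear_combination τ ^ 2 * hQe

/-- The arc to `v` itself is constant, so by compactness of `[0, 1]` the arcs to all nearby null
vectors avoid the finitely many kernels. They start at a multiple of `v`, whence the scalar `a`. -/
theorem eventually_joinedIn_nullOff {d : ℕ} {Q : QuadraticForm ℝ (Fin d → ℝ)}
    {L : Set (Hat d →ₗ[ℝ] ℝ)} (hL : L.Finite) {v : Hat d} (hv : v ∈ nullOff Q L) :
    ∀ᶠ u in 𝓝 v, Qhat Q u = 0 → ∃ a : ℝ, a ≠ 0 ∧ JoinedIn (nullOff Q L) v (a • u) := by
  obtain ⟨G, α, hG, hα, hαv, hGv, hG1, hG0, hGnull⟩ := exists_null_arcs Q hv.1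
  have h1 : ∀ᶠ u in 𝓝 v, ∀ τ ∈ Icc (0 : ℝ) 1, ∀ l ∈ L, l (G (u, τ)) ≠ 0 := by
    refine isCompact_Icc.eventually_forall_of_forall_eventually fun τ _ => ?_
    rw [eventually_all_finite hL]
    intro l hl
    have hcont : Continuous fun z => l (G z) :=
      (LinearMap.continuous_of_finiteDimensional l).comp hG
    exact hcont.continuousAt.eventually_ne (by rw [hGv]; exact hv.2 l hl)
  have h2 : ∀ᶠ u in 𝓝 v, α u ≠ 0 := hα.continuousAt.eventually_ne (by rw [hαv]; exact one_ne_zero)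
  filter_upwards [h1, h2] with u hu hαu hnull
  have hj : JoinedIn (nullOff Q L) (α u • v) u := by
    refine JoinedIn.ofLine (f := fun τ => G (u, τ)) (by fun_prop) (hG0 u) (hG1 u) ?_
    rintro _ ⟨τ, hτ, rfl⟩
    exact ⟨hGnull u τ hnull, hu τ hτ⟩
  refine ⟨(α u)⁻¹, inv_ne_zero hαu, ?_⟩
  have := hj.smul_nullOff (inv_ne_zero hαu)
  rwa [smul_smul, inv_mul_cancel₀ hαu, one_smul] at this

theorem continuous_mk_RP (d : ℕ) :
    Continuous (Projectivization.mk' ℝ : {v : Hat d // v ≠ 0} → RP d) :=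
  continuous_coinduced_rng

/-- `rep` is an arbitrary choice without continuity, so closeness of lines yields closeness of
vectors only after rescaling. The lines meeting an open set pull back to the union of its
rescalings, which is open. -/
theorem eventually_exists_rep {d : ℕ} (q : RP d) {U : Set (Hat d)} (hU : U ∈ 𝓝 q.rep) :
    ∀ᶠ q' in 𝓝 q, ∃ a : ℝ, a ≠ 0 ∧ a • q'.rep ∈ U := by
  obtain ⟨O, hOU, hO, hqO⟩ := mem_nhds_iff.1 hU
  refine mem_of_superset (IsOpen.mem_nhds (s := {q' : RP d | ∃ a : ℝ, a ≠ 0 ∧ a • q'.rep ∈ O}) ?_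
    ⟨1, one_ne_zero, by simpa using hqO⟩) fun q' ⟨a, ha, h⟩ => ⟨a, ha, hOU h⟩
  rw [isOpen_coinduced]
  have : (Projectivization.mk' ℝ : {v : Hat d // v ≠ 0} → RP d) ⁻¹'
      {q' : RP d | ∃ a : ℝ, a ≠ 0 ∧ a • q'.rep ∈ O} =
      ⋃ a ∈ {a : ℝ | a ≠ 0}, {v | a • v.1 ∈ O} := by
    ext ⟨v, hv⟩
    simp only [mem_preimage, mem_ofPred_eq, mem_iUnion, exists_prop, Projectivization.mk'_eq_mk]
    obtain ⟨b, hb⟩ := Projectivization.exists_smul_eq_mk_rep ℝ v hv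
    constructor
    · rintro ⟨a, ha, h⟩
      refine ⟨a * b, mul_ne_zero ha b.ne_zero, ?_⟩
      rw [← hb, Units.smul_def, smul_smul] at h
      exact h
    · rintro ⟨a, ha, h⟩
      refine ⟨a * (b : ℝ)⁻¹, mul_ne_zero ha (inv_ne_zero b.ne_zero), ?_⟩
      rw [← hb, Units.smul_def, smul_smul, mul_assoc, inv_mul_cancel₀ b.ne_zero, mul_one]
      exact h
  rw [this]
  exact isOpen_biUnion fun a _ => hO.preimage (by fun_prop)

/-- Points of a preconnected set of null lines at which no functional of the finite set `L`
vanishes are joined by paths of null vectors off the kernels of `L`. -/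
theorem IsPreconnected.joinedIn_nullOff {d : ℕ} {Q : QuadraticForm ℝ (Fin d → ℝ)}
    {L : Set (Hat d →ₗ[ℝ] ℝ)} (hL : L.Finite) {S : Set (RP d)} (hS : IsPreconnected S)
    (hSL : ∀ q ∈ S, q.rep ∈ nullOff Q L) {q q' : RP d} (hq : q ∈ S) (hq' : q' ∈ S) :
    ∃ a : ℝ, a ≠ 0 ∧ JoinedIn (nullOff Q L) q.rep (a • q'.rep) := by
  -- Being joined up to a non-zero scalar is transitive, symmetric and true locally, hence holds on
  -- all of a preconnected set.
  refine hS.induction₂ (fun q q' => ∃ a : ℝ, a ≠ 0 ∧ JoinedIn (nullOff Q L) q.rep (a • q'.rep))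
    (fun q hq => ?_) ?_ ?_ hq hq'
  · have h := eventually_exists_rep q (eventually_joinedIn_nullOff hL (hSL q hq))
    filter_upwards [nhdsWithin_le_nhds h, self_mem_nhdsWithin] with q' hq' hq'S
    obtain ⟨a, ha, h⟩ := hq'
    obtain ⟨b, hb, h⟩ := h (by rw [Qhat_smul, (hSL q' hq'S).1, mul_zero])
    exact ⟨b * a, mul_ne_zero hb ha, by rwa [smul_smul] at h⟩
  · rintro x y z - - - ⟨a, ha, h⟩ ⟨b, hb, h'⟩
    exact ⟨a * b, mul_ne_zero ha hb, h.trans (by simpa [smul_smul] using h'.smul_nullOff ha)⟩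
  · rintro x y - - ⟨a, ha, h⟩
    refine ⟨a⁻¹, inv_ne_zero ha, ?_⟩
    have := (h.smul_nullOff (inv_ne_zero ha)).symm
    rwa [smul_smul, inv_mul_cancel₀ ha, one_smul] at this

/-! ### Null lifts, and spheres as functionals. -/

/-- The null vector `(x, Q x, 1)` over `x`. -/
def nullLift {d : ℕ} (Q : QuadraticForm ℝ (Fin d → ℝ)) (x : Fin d → ℝ) : Hat d := (x, Q x, 1)

/-- The null vector `(0, 1, 0)` over `∞`. -/
def inftyVec (d : ℕ) : Hat d := (0, 1, 0)

theorem polarHat_apply {d : ℕ} (Q : QuadraticForm ℝ (Fin d → ℝ)) (u v : Hat d) :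
    polarHat Q u v = QuadraticMap.polar Q u.1 v.1 - u.2.1 * v.2.2 - v.2.1 * u.2.2 := by
  simp only [polarHat, QuadraticMap.polarBilin_apply_apply, QuadraticMap.polar, Qhat_apply,
    Prod.fst_add, Prod.snd_add]
  ring

theorem polarHat_inftyVec {d : ℕ} (Q : QuadraticForm ℝ (Fin d → ℝ)) (u : Hat d) :
    polarHat Q u (inftyVec d) = -u.2.2 := by
  rw [polarHat_apply]
  simp [inftyVec]

/-- This translates spacelike position into negativity of pairings of lifts, a condition that
similarities of `Q̂` respect. -/
theorem polarHat_nullLift {d : ℕ} (Q : QuadraticForm ℝ (Fin d → ℝ)) (x y : Fin d → ℝ) :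
    polarHat Q (nullLift Q x) (nullLift Q y) = -Q (x - y) := by
  have h : Q (x - y) = Q x + Q y - QuadraticMap.polar Q x y := by
    rw [sub_eq_add_neg, QuadraticMap.map_add Q, QuadraticMap.map_neg, QuadraticMap.polar_neg_right]
    ring
  rw [polarHat_apply, h]
  simp only [nullLift]
  ring

theorem Qhat_nullLift {d : ℕ} (Q : QuadraticForm ℝ (Fin d → ℝ)) (x : Fin d → ℝ) :
    Qhat Q (nullLift Q x) = 0 := by
  simp [Qhat_apply, nullLift]

theorem Qhat_inftyVec {d : ℕ} (Q : QuadraticForm ℝ (Fin d → ℝ)) : Qhat Q (inftyVec d) = 0 := by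
  simp [Qhat_apply, inftyVec]

theorem continuous_quadraticForm {d : ℕ} (Q : QuadraticForm ℝ (Fin d → ℝ)) : Continuous Q := by
  have h : ∀ x, Q x = 2⁻¹ * Q.polarBilin x x := fun x => by
    simp [QuadraticMap.polar_self]
  have h2 : Continuous fun x => Q.polarBilin x x :=
    ((LinearMap.toContinuousLinearMap.toLinearMap ∘ₗ Q.polarBilin :
      (Fin d → ℝ) →ₗ[ℝ] (Fin d → ℝ) →L[ℝ] ℝ).continuous_of_finiteDimensional).clm_apply
      continuous_id
  rw [show (Q : (Fin d → ℝ) → ℝ) = fun x => 2⁻¹ * Q.polarBilin x x from funext h]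
  exact continuous_const.mul h2

theorem continuous_nullLift {d : ℕ} (Q : QuadraticForm ℝ (Fin d → ℝ)) :
    Continuous (nullLift Q) :=
  continuous_id.prodMk ((continuous_quadraticForm Q).prodMk continuous_const)

/-- The functional `(y, a, b) ↦ a - φ y - D b`, which vanishes on the `Q`-sphere given by `φ`
and `D`. -/
def sphereFunctional {d : ℕ} (φ : (Fin d → ℝ) →ₗ[ℝ] ℝ) (D : ℝ) : Hat d →ₗ[ℝ] ℝ :=
  LinearMap.fst ℝ ℝ ℝ ∘ₗ LinearMap.snd ℝ (Fin d → ℝ) (ℝ × ℝ) -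
    φ ∘ₗ LinearMap.fst ℝ (Fin d → ℝ) (ℝ × ℝ) -
    D • (LinearMap.snd ℝ ℝ ℝ ∘ₗ LinearMap.snd ℝ (Fin d → ℝ) (ℝ × ℝ))

theorem sphereFunctional_apply {d : ℕ} (φ : (Fin d → ℝ) →ₗ[ℝ] ℝ) (D : ℝ) (v : Hat d) :
    sphereFunctional φ D v = v.2.1 - φ v.1 - D * v.2.2 := rfl

theorem functional_apply {d : ℕ} (l : Hat d →ₗ[ℝ] ℝ) (v : Hat d) :
    l v = l (v.1, 0, 0) + v.2.1 * l (inftyVec d) + v.2.2 * l (0, 0, 1) := by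
  rw [← smul_eq_mul, ← smul_eq_mul, ← map_smul, ← map_smul, ← map_add, ← map_add]
  simp [inftyVec]

theorem exists_eq_sphereFunctional {d : ℕ} (l : Hat d →ₗ[ℝ] ℝ) (hl : l (inftyVec d) = 1) :
    ∃ φ D, l = sphereFunctional φ D := by
  refine ⟨-(l ∘ₗ LinearMap.inl ℝ _ _), -l (0, 0, 1), LinearMap.ext fun v => ?_⟩
  rw [functional_apply l v, hl, sphereFunctional_apply]
  change _ = v.2.1 - -l (v.1, 0, 0) - -l (0, 0, 1) * v.2.2
  ring

theorem sphereFunctional_nullLift {d : ℕ} (Q : QuadraticForm ℝ (Fin d → ℝ))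
    (φ : (Fin d → ℝ) →ₗ[ℝ] ℝ) (D : ℝ) (x : Fin d → ℝ) :
    sphereFunctional φ D (nullLift Q x) = Q x - φ x - D := by
  simp [sphereFunctional_apply, nullLift]

theorem sphereFunctional_inftyVec {d : ℕ} (φ : (Fin d → ℝ) →ₗ[ℝ] ℝ) (D : ℝ) :
    sphereFunctional φ D (inftyVec d) = 1 := by
  simp [sphereFunctional_apply, inftyVec]

/-! ### General linear position and the families of empty and full spheres. -/

/-- A set of vectors annihilated by no non-zero functional on `(x, 1)` affinely spans. -/
theorem affineSpan_eq_top_of_annihilator {d : ℕ} {Z : Set (Fin d → ℝ)}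
    (h : ∀ (φ : (Fin d → ℝ) →ₗ[ℝ] ℝ) (D : ℝ), (∀ x ∈ Z, φ x + D = 0) → φ = 0 ∧ D = 0) :
    affineSpan ℝ Z = ⊤ := by
  have hne : Z.Nonempty := by
    by_contra hZ
    rw [not_nonempty_iff_eq_empty] at hZ
    exact one_ne_zero (h 0 1 (by simp [hZ])).2
  obtain ⟨z, hz⟩ := hne
  rw [AffineSubspace.affineSpan_eq_top_iff_vectorSpan_eq_top_of_nonempty ℝ _ _ ⟨z, hz⟩]
  by_contra hlt
  obtain ⟨φ, hφ, hle⟩ := Submodule.exists_le_ker_of_lt_top _ (lt_top_iff_ne_top.2 hlt)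
  refine hφ (h φ (-φ z) fun x hx => ?_).1
  have : φ (x - z) = 0 := hle (vsub_mem_vectorSpan ℝ hx hz)
  rw [map_sub] at this
  linarith

/-- A subset of a set in general linear position either lies on a `Q`-sphere or affinely spans. -/
theorem GeneralLinearPosition.dichotomy {d : ℕ} (Q : QuadraticForm ℝ (Fin d → ℝ))
    {X : Set (Fin d → ℝ)} (hX : GeneralLinearPosition X) {Z : Set (Fin d → ℝ)} (hZ : Z ⊆ X) :
    (∃ l : Hat d →ₗ[ℝ] ℝ, l (inftyVec d) = 1 ∧ ∀ x ∈ Z, l (nullLift Q x) = 0) ∨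
    ∀ m : Hat d →ₗ[ℝ] ℝ, m (inftyVec d) = 0 → (∀ x ∈ Z, m (nullLift Q x) = 0) → m = 0 := by
  rcases le_total Z.encard (d + 1) with hc | hc
  · left
    obtain ⟨φ, D, h⟩ := exists_affine_interpolation (hX Z hZ hc) Q
    refine ⟨sphereFunctional φ D, sphereFunctional_inftyVec φ D, fun x hx => ?_⟩
    rw [sphereFunctional_nullLift, ← h x hx]
    ring
  · right
    intro m hm0 hm
    obtain ⟨Y, hYZ, hY⟩ := Set.exists_subset_encard_eq hc
    have hind := hX Y (hYZ.trans hZ) hY.le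
    have hYfin : Y.Finite := Set.finite_of_encard_eq_coe (k := d + 1) (by simpa using hY)
    have : Fintype Y := hYfin.fintype
    have htop : affineSpan ℝ Y = ⊤ := by
      have := (hind.affineSpan_eq_top_iff_card_eq_finrank_add_one).2 (by
        rw [Module.finrank_fin_fun, ← Set.toFinset_card]
        rw [Set.encard_eq_coe_toFinset_card] at hY
        exact_mod_cast hY)
      simpa using this
    have hall : ∀ y : Fin d → ℝ, m (y, 0, 0) + m (0, 0, 1) = 0 := by
      intro y
      have hy : y ∈ affineSpan ℝ Y := by rw [htop]; trivial
      refine affineSpan_induction (p := fun y => m (y, 0, 0) + m (0, 0, 1) = 0) hy ?_ ?_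
      · intro x hx
        have := hm x (hYZ hx)
        rw [functional_apply, hm0] at this
        simpa [nullLift] using this
      · intro c u v w hu hv hw
        have he : ((c • (u - v) + w, 0, 0) : Hat d) =
            c • ((u, 0, 0) - (v, 0, 0)) + (w, 0, 0) := by simp
        simp only [vsub_eq_sub, vadd_eq_add]
        rw [he, map_add, map_smul, map_sub, smul_eq_mul]
        linear_combination c * hu - c * hv + hw
    have h0 : m (0, 0, 1) = 0 := by
      have h1 := hall 0
      have h2 : m (0, 0, 0) = 0 := map_zero m
      linarith
    refine LinearMap.ext fun v => ?_
    have := hall v.1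
    rw [h0, add_zero] at this
    rw [functional_apply, hm0, h0, this]
    simp

/-- Membership in the dual cone of the lifts of the points of `X`. -/
def NonnegOn {d : ℕ} (Q : QuadraticForm ℝ (Fin d → ℝ)) (X : Set (Fin d → ℝ))
    (l : Hat d →ₗ[ℝ] ℝ) : Prop :=
  ∀ x ∈ X, 0 ≤ l (nullLift Q x)

/-- The functional is determined up to scaling by its zeros among the lifts of `X`. -/
def IsFacetFunctional {d : ℕ} (Q : QuadraticForm ℝ (Fin d → ℝ)) (X : Set (Fin d → ℝ))
    (l : Hat d →ₗ[ℝ] ℝ) : Prop :=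
  ∀ m : Hat d →ₗ[ℝ] ℝ, (∀ x ∈ X, l (nullLift Q x) = 0 → m (nullLift Q x) = 0) → ∃ c : ℝ, m = c • l

/-- An affine function vanishing on the points of the sphere is a functional on `Hat d` that
vanishes at `∞`. Being a multiple of a functional with value 1 there, it is zero; so these points
affinely span the whole space. -/
theorem IsFacetFunctional.circumscribed {d : ℕ} {Q : QuadraticForm ℝ (Fin d → ℝ)}
    {X : Set (Fin d → ℝ)} {φ : (Fin d → ℝ) →ₗ[ℝ] ℝ} {D : ℝ}
    (h : IsFacetFunctional Q X (sphereFunctional φ D)) : Circumscribed Q X φ D := by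
  have htop : affineSpan ℝ {x ∈ X | Q x = φ x + D} = ⊤ := by
    refine affineSpan_eq_top_of_annihilator fun ψ E hψ => ?_
    obtain ⟨c, hc⟩ := h (sphereFunctional 0 0 - sphereFunctional ψ E) fun x hx h0 => by
      rw [sphereFunctional_nullLift] at h0
      have := hψ x ⟨hx, by linarith⟩
      rw [LinearMap.sub_apply, sphereFunctional_nullLift, sphereFunctional_nullLift]
      simp only [LinearMap.zero_apply]
      linarith
    have hc0 : c = 0 := by
      have := LinearMap.congr_fun hc (inftyVec d)
      simpa [sphereFunctional_inftyVec] using this.symm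
    rw [hc0, zero_smul, sub_eq_zero] at hc
    constructor
    · refine LinearMap.ext fun v => ?_
      have := LinearMap.congr_fun hc (v, 0, 0)
      simpa [sphereFunctional_apply] using this
    · have := LinearMap.congr_fun hc (0, 0, 1)
      simpa [sphereFunctional_apply] using this.symm
  exact htop.trans (top_le_iff.1 (htop ▸ affineSpan_mono ℝ (fun x hx => hx.1))).symm

/-- After normalization at `∞`, a facet functional is recovered from its zero set, and `X` has
finitely many subsets. -/
theorem finite_facetFunctionals {d : ℕ} (Q : QuadraticForm ℝ (Fin d → ℝ))
    {X : Set (Fin d → ℝ)} (hX : X.Finite) :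
    {l : Hat d →ₗ[ℝ] ℝ | l (inftyVec d) = 1 ∧ IsFacetFunctional Q X l}.Finite := by
  refine Set.Finite.of_finite_image (f := fun l => {x ∈ X | l (nullLift Q x) = 0})
    (hX.finite_subsets.subset ?_) ?_
  · rintro _ ⟨l, -, rfl⟩
    exact fun x hx => hx.1
  · rintro l ⟨hl1, hl⟩ l' ⟨hl1', -⟩ heq
    obtain ⟨c, hc⟩ := hl l' fun x hx h0 => by
      have : x ∈ {x ∈ X | l (nullLift Q x) = 0} := ⟨hx, h0⟩
      have heq' : {x ∈ X | l (nullLift Q x) = 0} = {x ∈ X | l' (nullLift Q x) = 0} := heq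
      rw [heq'] at this
      exact this.2
    have := LinearMap.congr_fun hc (inftyVec d)
    rw [hl1', LinearMap.smul_apply, hl1, smul_eq_mul, mul_one] at this
    rw [hc, ← this, one_smul]

/-- A finite family of empty spheres bounding the lower hull, together with a finite family of full
spheres controlling the supporting functionals that are positive at a given vector `p`. -/
theorem exists_sphere_families {d : ℕ} (Q : QuadraticForm ℝ (Fin d → ℝ)) {X : Set (Fin d → ℝ)}
    (hfin : X.Finite) (hX : GeneralLinearPosition X) :
    ∃ L M : Set (Hat d →ₗ[ℝ] ℝ), L.Finite ∧ M.Finite ∧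
      (∀ l ∈ L, NonnegOn Q X l ∧ ∃ φ D, l = sphereFunctional φ D ∧ IsEmptySphere Q X φ D) ∧
      (∀ l ∈ M, ∃ φ D, l = sphereFunctional φ D ∧ IsFullSphere Q X φ D) ∧
      (∀ l, NonnegOn Q X l → 0 < l (inftyVec d) →
        ∀ w, (∀ m, NonnegOn Q X m → 0 ≤ m w) →
        ∃ l' ∈ L, (∀ x ∈ X, l (nullLift Q x) = 0 → l' (nullLift Q x) = 0) ∧
          l (inftyVec d) * l' w ≤ l w) ∧
      (∀ l p, NonnegOn Q X l → 0 < l p → (∀ m ∈ M, 0 < m p) →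
        ∃ l', NonnegOn Q X l' ∧ 0 < l' (inftyVec d) ∧
          ∀ x ∈ X, l (nullLift Q x) = 0 → l' (nullLift Q x) = 0) := by
  -- If `X` lies on one sphere, its functional alone does everything. Otherwise the lifts are
  -- annihilated by no non-zero functional, and the facet lemma applies.
  by_cases hA : ∃ l : Hat d →ₗ[ℝ] ℝ, l (inftyVec d) = 1 ∧ ∀ x ∈ X, l (nullLift Q x) = 0
  · obtain ⟨l₀, hl₀, hl₀X⟩ := hA
    refine ⟨{l₀}, ∅, finite_singleton _, finite_empty, ?_, by simp, ?_, ?_⟩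
    · rintro l rfl
      obtain ⟨φ, D, rfl⟩ := exists_eq_sphereFunctional l hl₀
      have h : ∀ x ∈ X, Q x = φ x + D := fun x hx => by
        have := hl₀X x hx
        rw [sphereFunctional_nullLift] at this
        linarith
      refine ⟨fun x hx => (hl₀X x hx).ge, φ, D, rfl, ?_, fun x hx => (h x hx).not_lt⟩
      rw [Circumscribed, Set.sep_eq_self_iff_mem_true.2 h]
    · intro l hl hl0 w hw
      refine ⟨l₀, rfl, fun x hx _ => hl₀X x hx, ?_⟩
      have h1 := hw l₀ fun x hx => (hl₀X x hx).ge
      have h2 := hw (-l₀) fun x hx => by simp [hl₀X x hx]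
      rw [LinearMap.neg_apply] at h2
      have h3 := hw l hl
      nlinarith
    · intro l p hl hlp _
      exact ⟨l₀, fun x hx => (hl₀X x hx).ge, by rw [hl₀]; exact one_pos, fun x hx _ => hl₀X x hx⟩
  · have hspan' : ∀ m : Hat d →ₗ[ℝ] ℝ, (∀ x ∈ X, m (nullLift Q x) = 0) → m = 0 := by
      intro m hm
      have hm0 : m (inftyVec d) = 0 := by
        by_contra hne
        exact hA ⟨(m (inftyVec d))⁻¹ • m, by simp [hne], fun x hx => by simp [hm x hx]⟩
      rcases hX.dichotomy Q subset_rfl with h | h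
      · exact absurd h hA
      · exact h m hm0 hm
    have hspan : ∀ m : Hat d →ₗ[ℝ] ℝ, (∀ v ∈ nullLift Q '' X, m v = 0) → m = 0 :=
      fun m hm => hspan' m (by simpa using hm)
    have hfin' := finite_facetFunctionals Q hfin
    have facet : ∀ (l : Hat d →ₗ[ℝ] ℝ) (v w : Hat d), NonnegOn Q X l → 0 < l v →
        (∀ m, NonnegOn Q X m → 0 ≤ m w) → ∃ l', NonnegOn Q X l' ∧ l' v = l v ∧ l' w ≤ l w ∧
          (∀ x ∈ X, l (nullLift Q x) = 0 → l' (nullLift Q x) = 0) ∧ IsFacetFunctional Q X l' := by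
      intro l v w hl hlv hw
      obtain ⟨l', h1, h2, h3, h4, h5⟩ := exists_facet_functional (hfin.image (nullLift Q)) hspan
        (v := v) (w := w) (fun m hm => hw m (by simpa [NonnegOn] using hm)) l
        (by simpa [NonnegOn] using hl) hlv
      exact ⟨l', by simpa [NonnegOn] using h1, h2, h3, by simpa using h4,
        fun m hm => h5 m (by simpa using hm)⟩
    refine ⟨{l | NonnegOn Q X l ∧ l (inftyVec d) = 1 ∧ IsFacetFunctional Q X l},
      {l | NonnegOn Q X (-l) ∧ l (inftyVec d) = 1 ∧ IsFacetFunctional Q X l},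
      hfin'.subset fun l hl => hl.2, hfin'.subset fun l hl => hl.2, ?_, ?_, ?_, ?_⟩
    · rintro l ⟨hl, hl1, hlf⟩
      obtain ⟨φ, D, rfl⟩ := exists_eq_sphereFunctional l hl1
      refine ⟨hl, φ, D, rfl, hlf.circumscribed, fun x hx => ?_⟩
      have := hl x hx
      rw [sphereFunctional_nullLift] at this
      linarith
    · rintro l ⟨hl, hl1, hlf⟩
      obtain ⟨φ, D, rfl⟩ := exists_eq_sphereFunctional l hl1
      refine ⟨φ, D, rfl, hlf.circumscribed, fun x hx => ?_⟩
      have := hl x hx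
      rw [LinearMap.neg_apply, sphereFunctional_nullLift] at this
      linarith
    · intro l hl hl0 w hw
      obtain ⟨l', h1, h2, h3, h4, h5⟩ := facet l (inftyVec d) w hl hl0 hw
      refine ⟨(l (inftyVec d))⁻¹ • l', ⟨fun x hx => ?_, ?_, fun m hm => ?_⟩, fun x hx h0 => ?_, ?_⟩
      · exact mul_nonneg (inv_nonneg.2 hl0.le) (h1 x hx)
      · simp [h2, hl0.ne']
      · obtain ⟨c, hc⟩ := h5 m fun x hx h0 => hm x hx (by simp [h0])
        exact ⟨c * l (inftyVec d), by rw [hc, smul_smul, mul_assoc, mul_inv_cancel₀ hl0.ne',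
          mul_one]⟩
      · simp [h4 x hx h0]
      · rw [LinearMap.smul_apply, smul_eq_mul, mul_inv_cancel_left₀ hl0.ne']
        exact h3
    · intro l p hl hlp hM
      obtain ⟨l', h1, h2, -, h4, h5⟩ := facet l p 0 hl hlp (by simp)
      rcases lt_trichotomy (l' (inftyVec d)) 0 with hneg | hzero | hpos
      -- If the facet functional is negative at `∞`, its normalization defines a full sphere and
      -- would be negative at `p`, against `hM`.
      · exfalso
        have hmem := hM ((l' (inftyVec d))⁻¹ • l') ⟨fun x hx => ?_, ?_, fun m hm => ?_⟩
        · rw [LinearMap.smul_apply, smul_eq_mul, h2] at hmem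
          nlinarith [inv_lt_zero.2 hneg]
        · rw [LinearMap.neg_apply, LinearMap.smul_apply, smul_eq_mul]
          nlinarith [inv_lt_zero.2 hneg, h1 x hx]
        · simp [hneg.ne]
        · obtain ⟨c, hc⟩ := h5 m fun x hx h0 => hm x hx (by simp [h0])
          exact ⟨c * l' (inftyVec d), by rw [hc, smul_smul, mul_assoc, mul_inv_cancel₀ hneg.ne,
            mul_one]⟩
      -- No facet is vertical: its zeros either lie on a sphere, whose functional would be a
      -- multiple of `l'` yet non-zero at `∞`, or force `l' = 0`.
      · exfalso
        rcases hX.dichotomy Q (Z := {x ∈ X | l' (nullLift Q x) = 0}) (fun x hx => hx.1) with h | h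
        · obtain ⟨m, hm1, hm⟩ := h
          obtain ⟨c, hc⟩ := h5 m fun x hx h0 => hm x ⟨hx, h0⟩
          rw [hc, LinearMap.smul_apply, hzero, smul_zero] at hm1
          exact zero_ne_one hm1
        · have := h l' hzero fun x hx => hx.2
          rw [this] at h2
          simp at h2
          exact hlp.ne h2
      · exact ⟨l', h1, hpos, h4⟩

/-! ### The hull of the lifts, its lower faces and its lower boundary. -/

theorem sep_convexHull_eq_zero {V : Type*} [AddCommGroup V] [Module ℝ V] {S : Set V}
    (l : V →ₗ[ℝ] ℝ) (hl : ∀ v ∈ S, 0 ≤ l v) :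
    {v ∈ convexHull ℝ S | l v = 0} = convexHull ℝ {v ∈ S | l v = 0} := by
  apply subset_antisymm
  · rintro v ⟨hv, hv0⟩
    suffices v ∈ {v | 0 ≤ l v ∧ (l v = 0 → v ∈ convexHull ℝ {v ∈ S | l v = 0})} from this.2 hv0
    refine convexHull_min ?_ ?_ hv
    · exact fun u hu => ⟨hl u hu, fun h => subset_convexHull ℝ _ ⟨hu, h⟩⟩
    rintro u ⟨hu, hu'⟩ w ⟨hw, hw'⟩ a b ha hb hab
    have he : l (a • u + b • w) = a * l u + b * l w := by simp
    refine ⟨by rw [he]; positivity, fun h0 => ?_⟩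
    rw [he] at h0
    have h1 : a * l u = 0 := by nlinarith [mul_nonneg ha hu, mul_nonneg hb hw]
    have h2 : b * l w = 0 := by nlinarith [mul_nonneg ha hu, mul_nonneg hb hw]
    rcases mul_eq_zero.1 h1 with h | h
    · rcases mul_eq_zero.1 h2 with h' | h'
      · linarith
      · have : b = 1 := by linarith
        simpa [h, this] using hw' h'
    · rcases mul_eq_zero.1 h2 with h' | h'
      · have : a = 1 := by linarith
        simpa [h', this] using hu' h
      · exact (convex_convexHull ℝ _) (hu' h) (hw' h') ha hb hab
  · refine convexHull_min (fun v hv => ⟨subset_convexHull ℝ S hv.1, hv.2⟩) ?_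
    exact (convex_convexHull ℝ S).inter (convex_hyperplane l.isLinear 0)

/-- The convex hull of the lifts of the points of `X`, in the hyperplane `b = 1` of `ℝ^{d+2}`. -/
def hatHull {d : ℕ} (Q : QuadraticForm ℝ (Fin d → ℝ)) (X : Set (Fin d → ℝ)) : Set (Hat d) :=
  convexHull ℝ (nullLift Q '' X)

theorem functional_nonneg_of_mem_hatHull {d : ℕ} {Q : QuadraticForm ℝ (Fin d → ℝ)}
    {X : Set (Fin d → ℝ)} {v : Hat d} (hv : v ∈ hatHull Q X) {l : Hat d →ₗ[ℝ] ℝ}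
    (hl : NonnegOn Q X l) : 0 ≤ l v := by
  refine convexHull_min (t := {v | 0 ≤ l v}) ?_ (convex_halfSpace_ge l.isLinear 0) hv
  rintro _ ⟨x, hx, rfl⟩
  exact hl x hx

theorem functional_pos_of_mem_hatHull {d : ℕ} {Q : QuadraticForm ℝ (Fin d → ℝ)}
    {X : Set (Fin d → ℝ)} {v : Hat d} (hv : v ∈ hatHull Q X) {l : Hat d →ₗ[ℝ] ℝ}
    (hl : ∀ x ∈ X, 0 < l (nullLift Q x)) : 0 < l v := by
  refine convexHull_min (t := {v | 0 < l v}) ?_ (convex_halfSpace_gt l.isLinear 0) hv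
  rintro _ ⟨x, hx, rfl⟩
  exact hl x hx

theorem snd_snd_of_mem_hatHull {d : ℕ} {Q : QuadraticForm ℝ (Fin d → ℝ)}
    {X : Set (Fin d → ℝ)} {v : Hat d} (hv : v ∈ hatHull Q X) : v.2.2 = 1 := by
  refine convexHull_min (t := {v : Hat d | v.2.2 = 1}) ?_ ?_ hv
  · rintro _ ⟨x, -, rfl⟩
    rfl
  · exact convex_hyperplane
      (LinearMap.snd ℝ ℝ ℝ ∘ₗ LinearMap.snd ℝ (Fin d → ℝ) (ℝ × ℝ)).isLinear 1

theorem image_fst_hatHull {d : ℕ} (Q : QuadraticForm ℝ (Fin d → ℝ)) (X : Set (Fin d → ℝ)) :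
    Prod.fst '' hatHull Q X = convexHull ℝ X := by
  have := LinearMap.image_convexHull (LinearMap.fst ℝ (Fin d → ℝ) (ℝ × ℝ)) (nullLift Q '' X)
  rw [image_image] at this
  simpa [nullLift, hatHull] using this

theorem nullLift_mem_hatHull {d : ℕ} (Q : QuadraticForm ℝ (Fin d → ℝ)) {X : Set (Fin d → ℝ)}
    {x : Fin d → ℝ} (hx : x ∈ X) : nullLift Q x ∈ hatHull Q X :=
  subset_convexHull ℝ _ (mem_image_of_mem _ hx)

/-- All pairings of lifts are nonpositive, so by bilinearity are all pairings of points of the hull;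
the diagonal gives the form. -/
theorem Qhat_nonpos_of_mem_hatHull {d : ℕ} {Q : QuadraticForm ℝ (Fin d → ℝ)}
    {X : Set (Fin d → ℝ)} (hX : SpacelikePosition Q X) {v : Hat d} (hv : v ∈ hatHull Q X) :
    Qhat Q v ≤ 0 := by
  have h1 : ∀ x ∈ X, NonnegOn Q X (-(polarHat Q (nullLift Q x))) := by
    intro x hx y hy
    rw [LinearMap.neg_apply, polarHat_nullLift, neg_neg]
    rcases eq_or_ne x y with rfl | h
    · simp
    · exact (hX x hx y hy h).le
  have h2 : NonnegOn Q X (-(polarHat Q v)) := by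
    intro x hx
    have := functional_nonneg_of_mem_hatHull hv (h1 x hx)
    rw [LinearMap.neg_apply] at this ⊢
    rwa [polarHat_comm]
  have := functional_nonneg_of_mem_hatHull hv h2
  rw [LinearMap.neg_apply, polarHat_self] at this
  linarith

theorem nullLift_eq_of_mem_hatHull {d : ℕ} {Q : QuadraticForm ℝ (Fin d → ℝ)}
    {X : Set (Fin d → ℝ)} {v : Hat d} (hv : v ∈ hatHull Q X) :
    nullLift Q v.1 + (-Qhat Q v) • inftyVec d = v := by
  have := snd_snd_of_mem_hatHull hv
  rw [Qhat_apply, this]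
  ext <;> simp [nullLift, inftyVec, this]

/-- The points of `X` in the convex hull of the zeros of a lower supporting functional are those
zeros. -/
theorem inter_convexHull_zeros {d : ℕ} {Q : QuadraticForm ℝ (Fin d → ℝ)}
    {X : Set (Fin d → ℝ)} (hX : SpacelikePosition Q X) {l : Hat d →ₗ[ℝ] ℝ}
    (hl : NonnegOn Q X l) (hl0 : 0 < l (inftyVec d)) :
    X ∩ convexHull ℝ {x ∈ X | l (nullLift Q x) = 0} = {x ∈ X | l (nullLift Q x) = 0} := by
  refine subset_antisymm ?_ fun x hx => ⟨hx.1, subset_convexHull ℝ _ hx⟩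
  rintro x ⟨hx, hxI⟩
  rw [← image_fst_hatHull Q] at hxI
  obtain ⟨v, hv, rfl⟩ := hxI
  have hv' : v ∈ hatHull Q X := convexHull_mono (image_mono fun x hx => hx.1) hv
  have hlv : 0 ≤ (-l) v := functional_nonneg_of_mem_hatHull hv fun x hx => by simp [hx.2]
  rw [LinearMap.neg_apply, ← nullLift_eq_of_mem_hatHull hv', map_add, map_smul, smul_eq_mul] at hlv
  refine ⟨hx, le_antisymm ?_ (hl _ hx)⟩
  -- The hull point `v` lies on or above the lift of `v.1`, and `l` increases upwards, so `l v ≤ 0`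
  -- passes down to the lift.
  nlinarith [Qhat_nonpos_of_mem_hatHull hX hv']

theorem liftedHull_eq {d : ℕ} (Q : QuadraticForm ℝ (Fin d → ℝ)) (X : Set (Fin d → ℝ)) :
    liftedHull Q X = (fun v : Hat d => (v.1, v.2.1)) '' hatHull Q X := by
  have := LinearMap.image_convexHull ((LinearMap.fst ℝ (Fin d → ℝ) (ℝ × ℝ)).prod
    (LinearMap.fst ℝ ℝ ℝ ∘ₗ LinearMap.snd ℝ (Fin d → ℝ) (ℝ × ℝ))) (nullLift Q '' X)
  rw [image_image] at this
  exact this.symm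

theorem functional_split {d : ℕ} (l : Hat d →ₗ[ℝ] ℝ) (v : Hat d) :
    l v = l (v.1, v.2.1, 0) + v.2.2 * l (0, 0, 1) := by
  rw [← smul_eq_mul, ← map_smul, ← map_add]
  simp

theorem image_fst_face {d : ℕ} {Q : QuadraticForm ℝ (Fin d → ℝ)} {X : Set (Fin d → ℝ)}
    {l : Hat d →ₗ[ℝ] ℝ} (hl : NonnegOn Q X l) {x₀ : Fin d → ℝ} (hx₀ : x₀ ∈ X)
    (h0 : l (nullLift Q x₀) = 0) :
    Prod.fst '' {z ∈ liftedHull Q X |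
      ∀ w ∈ liftedHull Q X, l (z.1, z.2, 0) ≤ l (w.1, w.2, 0)} =
      convexHull ℝ {x ∈ X | l (nullLift Q x) = 0} := by
  have hsep := sep_convexHull_eq_zero (S := nullLift Q '' X) l (by simpa [NonnegOn] using hl)
  have h1 : {v ∈ nullLift Q '' X | l v = 0} = nullLift Q '' {x ∈ X | l (nullLift Q x) = 0} := by
    ext v
    constructor
    · rintro ⟨⟨x, hx, rfl⟩, h⟩
      exact ⟨x, ⟨hx, h⟩, rfl⟩
    · rintro ⟨x, ⟨hx, h⟩, rfl⟩
      exact ⟨⟨x, hx, rfl⟩, h⟩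
  rw [h1] at hsep
  change {v ∈ hatHull Q X | l v = 0} = hatHull Q {x ∈ X | l (nullLift Q x) = 0} at hsep
  rw [← image_fst_hatHull Q, ← hsep, liftedHull_eq]
  ext y
  constructor
  · rintro ⟨_, ⟨⟨v, hv, rfl⟩, hmin⟩, rfl⟩
    refine ⟨v, ⟨hv, le_antisymm ?_ (functional_nonneg_of_mem_hatHull hv hl)⟩, rfl⟩
    have := hmin _ ⟨_, nullLift_mem_hatHull Q hx₀, rfl⟩
    rw [← h0, functional_split l v, functional_split l (nullLift Q x₀),
      snd_snd_of_mem_hatHull hv, snd_snd_of_mem_hatHull (nullLift_mem_hatHull Q hx₀)]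
    simpa using this
  · rintro ⟨v, ⟨hv, hv0⟩, rfl⟩
    refine ⟨_, ⟨⟨v, hv, rfl⟩, ?_⟩, rfl⟩
    rintro _ ⟨u, hu, rfl⟩
    have := functional_nonneg_of_mem_hatHull hu hl
    rw [← hv0, functional_split l v, functional_split l u,
      snd_snd_of_mem_hatHull hv, snd_snd_of_mem_hatHull hu] at this
    simpa using this

/-- The cells of the Delaunay decomposition are the convex hulls of the non-empty zero sets of the
supporting functionals of the lifts that are positive at `∞`. -/
theorem mem_Del_iff {d : ℕ} {Q : QuadraticForm ℝ (Fin d → ℝ)} {X : Set (Fin d → ℝ)}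
    (hfin : X.Finite) (Δ : Set (Fin d → ℝ)) :
    Δ ∈ Del Q X ↔ ∃ l : Hat d →ₗ[ℝ] ℝ, NonnegOn Q X l ∧ 0 < l (inftyVec d) ∧
      {x ∈ X | l (nullLift Q x) = 0}.Nonempty ∧
      Δ = convexHull ℝ {x ∈ X | l (nullLift Q x) = 0} := by
  constructor
  · rintro ⟨F, ⟨hFne, n, hn, rfl⟩, rfl⟩
    have hne : X.Nonempty := by
      obtain ⟨z, hz, -⟩ := hFne
      have : ((fun x => (x, Q x)) '' X).Nonempty := convexHull_nonempty_iff.1 ⟨z, hz⟩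
      exact this.of_image
    obtain ⟨x₀, hx₀, hmin⟩ := Set.exists_min_image X (fun x => n (x, Q x)) hfin hne
    set l : Hat d →ₗ[ℝ] ℝ := n ∘ₗ ((LinearMap.fst ℝ (Fin d → ℝ) (ℝ × ℝ)).prod
      (LinearMap.fst ℝ ℝ ℝ ∘ₗ LinearMap.snd ℝ (Fin d → ℝ) (ℝ × ℝ))) -
      n (x₀, Q x₀) • (LinearMap.snd ℝ ℝ ℝ ∘ₗ LinearMap.snd ℝ (Fin d → ℝ) (ℝ × ℝ)) with hl
    have hlap : ∀ v, l v = n (v.1, v.2.1) - n (x₀, Q x₀) * v.2.2 := fun v => rfl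
    have hnn : NonnegOn Q X l := by
      intro x hx
      have := hmin x hx
      rw [hlap]
      simp only [nullLift, mul_one]
      linarith
    have hzero : l (nullLift Q x₀) = 0 := by
      rw [hlap]
      simp [nullLift]
    refine ⟨l, hnn, by rw [hlap]; simpa [inftyVec] using hn, ⟨x₀, hx₀, hzero⟩, ?_⟩
    rw [← image_fst_face hnn hx₀ hzero]
    simp [hlap]
  · rintro ⟨l, hl, hl0, ⟨x₀, hx₀, hzero⟩, rfl⟩
    refine ⟨_, ⟨?_, l ∘ₗ ((LinearMap.inl ℝ (Fin d → ℝ) (ℝ × ℝ)).coprod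
      (LinearMap.inr ℝ (Fin d → ℝ) (ℝ × ℝ) ∘ₗ LinearMap.inl ℝ ℝ ℝ)), ?_, rfl⟩, ?_⟩
    · have h1 := image_fst_face hl hx₀ hzero
      have h2 : (convexHull ℝ {x ∈ X | l (nullLift Q x) = 0}).Nonempty :=
        ⟨x₀, subset_convexHull ℝ _ ⟨hx₀, hzero⟩⟩
      rw [← h1] at h2
      simpa using h2.of_image
    · simpa [inftyVec] using hl0
    · rw [← image_fst_face hl hx₀ hzero]
      simp

/-- The lower boundary of the hull of the lifts, as a continuous height function. -/
theorem exists_lower_height {d : ℕ} {Q : QuadraticForm ℝ (Fin d → ℝ)} {X : Set (Fin d → ℝ)}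
    (hfin : X.Finite) (hne : X.Nonempty) {L : Set (Hat d →ₗ[ℝ] ℝ)} (hL : L.Finite)
    (hL1 : ∀ l ∈ L, NonnegOn Q X l ∧ l (inftyVec d) = 1)
    (hLP : ∀ l, NonnegOn Q X l → 0 < l (inftyVec d) →
        ∀ w, (∀ m, NonnegOn Q X m → 0 ≤ m w) → ∃ l' ∈ L, l (inftyVec d) * l' w ≤ l w) :
    ∃ h : (Fin d → ℝ) → ℝ, Continuous h ∧ ∀ y ∈ convexHull ℝ X,
      ((y, h y, 1) : Hat d) ∈ hatHull Q X ∧ ∃ l ∈ L, l (y, h y, 1) = 0 := by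
  have hLne : hL.toFinset.Nonempty := by
    obtain ⟨x₀, -, hmin⟩ := Set.exists_min_image X Q hfin hne
    obtain ⟨l, hl, -⟩ := hLP (sphereFunctional 0 (Q x₀)) (fun x hx => by
      rw [sphereFunctional_nullLift]
      have := hmin x hx
      simpa using this) (by rw [sphereFunctional_inftyVec]; exact one_pos) 0 (by simp)
    exact ⟨l, by simpa using hl⟩
  have hsplit : ∀ (l : Hat d →ₗ[ℝ] ℝ) (y : Fin d → ℝ) (a : ℝ),
      l (y, a, 1) = a * l (inftyVec d) + l (y, 0, 1) := by
    intro l y a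
    rw [← smul_eq_mul, ← map_smul, ← map_add]
    simp [inftyVec]
  -- The least height at which every functional of `L` is nonnegative; each has value 1 at `∞`.
  refine ⟨fun y => hL.toFinset.sup' hLne fun l => -l (y, 0, 1), ?_, fun y hy => ?_⟩
  · refine Continuous.finset_sup'_apply hLne fun l _ => ?_
    have := LinearMap.continuous_of_finiteDimensional l
    fun_prop
  · set a₀ := hL.toFinset.sup' hLne fun l => -l (y, 0, 1) with ha₀
    have hle : ∀ l ∈ L, 0 ≤ l (y, a₀, 1) := by
      intro l hl
      rw [hsplit, (hL1 l hl).2]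
      have := Finset.le_sup' (fun l : Hat d →ₗ[ℝ] ℝ => -l (y, 0, 1))
        (show l ∈ hL.toFinset by simpa using hl)
      rw [← ha₀] at this
      linarith
    obtain ⟨l₀, hl₀, hl₀'⟩ := Finset.exists_mem_eq_sup' hLne fun l : Hat d →ₗ[ℝ] ℝ => -l (y, 0, 1)
    rw [← ha₀] at hl₀'
    have hl₀L : l₀ ∈ L := by simpa using hl₀
    have hzero : l₀ (y, a₀, 1) = 0 := by
      rw [hsplit, (hL1 l₀ hl₀L).2]
      linarith
    refine ⟨?_, l₀, hl₀L, hzero⟩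
    -- A functional `l` separating the point from the hull is nonnegative at a hull point `v` above
    -- it, so it is positive at `∞`. The member of `L` bounded by `l` at `v` would then be negative
    -- at the point, against `hle`.
    by_contra hnot
    obtain ⟨f, u, hfu, hfK⟩ := geometric_hahn_banach_point_closed (convex_convexHull ℝ _)
      ((hfin.image (nullLift Q)).isCompact_convexHull ℝ).isClosed hnot
    rw [← image_fst_hatHull Q] at hy
    obtain ⟨v, hv, rfl⟩ := hy
    set l : Hat d →ₗ[ℝ] ℝ := f.toLinearMap -
      u • (LinearMap.snd ℝ ℝ ℝ ∘ₗ LinearMap.snd ℝ (Fin d → ℝ) (ℝ × ℝ)) with hl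
    have hlap : ∀ v, l v = f v - u * v.2.2 := fun v => rfl
    have hvsplit : ∀ m : Hat d →ₗ[ℝ] ℝ,
        m v = m (v.1, a₀, 1) + (v.2.1 - a₀) * m (inftyVec d) := by
      intro m
      rw [← smul_eq_mul, ← map_smul, ← map_add]
      congr 1
      ext <;> simp [inftyVec, snd_snd_of_mem_hatHull hv]
    have hnn : NonnegOn Q X l := by
      intro x hx
      have := hfK _ (nullLift_mem_hatHull Q hx)
      rw [hlap]
      simp only [nullLift, mul_one] at this ⊢
      linarith
    have hneg : l (v.1, a₀, 1) < 0 := by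
      rw [hlap]
      simp only [mul_one]
      linarith
    have hge := functional_nonneg_of_mem_hatHull hv (hL1 l₀ hl₀L).1
    rw [hvsplit, hzero, (hL1 l₀ hl₀L).2] at hge
    have hlv := functional_nonneg_of_mem_hatHull hv hnn
    have hl0 : 0 < l (inftyVec d) := by
      have := hvsplit l
      by_contra! hcon
      nlinarith
    obtain ⟨l', hl', hw⟩ := hLP l hnn hl0 v fun m hm => functional_nonneg_of_mem_hatHull hv hm
    rw [hvsplit l', hvsplit l, (hL1 l' hl').2] at hw
    nlinarith [hle l' hl', mul_nonneg hl0.le (hle l' hl')]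

/-! ### From vectors to projective points and the affine chart. -/

/-- The line through a vector, with the junk value `∞` at `0`. -/
def toRP {d : ℕ} (v : Hat d) : RP d :=
  open Classical in if h : v ≠ 0 then Projectivization.mk ℝ v h else inftyPt d

theorem toRP_of_ne {d : ℕ} {v : Hat d} (h : v ≠ 0) : toRP v = Projectivization.mk ℝ v h :=
  dif_pos h

theorem nullLift_ne_zero {d : ℕ} (Q : QuadraticForm ℝ (Fin d → ℝ)) (x : Fin d → ℝ) :
    nullLift Q x ≠ 0 :=
  fun h => one_ne_zero (congrArg (fun v => v.2.2) h)

theorem inftyVec_ne_zero (d : ℕ) : inftyVec d ≠ 0 :=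
  fun h => one_ne_zero (congrArg (fun v => v.2.1) h)

theorem toRP_nullLift {d : ℕ} (Q : QuadraticForm ℝ (Fin d → ℝ)) (x : Fin d → ℝ) :
    toRP (nullLift Q x) = chart Q x :=
  toRP_of_ne (nullLift_ne_zero Q x)

theorem toRP_inftyVec (d : ℕ) : toRP (inftyVec d) = inftyPt d :=
  toRP_of_ne (inftyVec_ne_zero d)

theorem toRP_smul {d : ℕ} {a : ℝ} (ha : a ≠ 0) (v : Hat d) : toRP (a • v) = toRP v := by
  by_cases hv : v = 0
  · simp [hv]
  · rw [toRP_of_ne hv, toRP_of_ne (smul_ne_zero ha hv), Projectivization.mk_eq_mk_iff']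
    exact ⟨a, rfl⟩

theorem exists_smul_of_toRP_eq {d : ℕ} {v w : Hat d} (hv : v ≠ 0) (hw : w ≠ 0)
    (h : toRP v = toRP w) : ∃ a : ℝ, a ≠ 0 ∧ v = a • w := by
  rw [toRP_of_ne hv, toRP_of_ne hw, Projectivization.mk_eq_mk_iff'] at h
  obtain ⟨a, rfl⟩ := h
  exact ⟨a, fun ha => hv (by simp [ha]), rfl⟩

theorem exists_rep_toRP {d : ℕ} {v : Hat d} (hv : v ≠ 0) :
    ∃ a : ℝ, a ≠ 0 ∧ (toRP v).rep = a • v := by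
  rw [toRP_of_ne hv]
  obtain ⟨a, ha⟩ := Projectivization.exists_smul_eq_mk_rep ℝ v hv
  exact ⟨a, a.ne_zero, ha.symm⟩

theorem continuousOn_toRP (d : ℕ) : ContinuousOn (toRP : Hat d → RP d) {v | v ≠ 0} := by
  rw [continuousOn_iff_continuous_domRestrict,
    show domRestrict {v : Hat d | v ≠ 0} toRP = Projectivization.mk' ℝ from
      funext fun v => toRP_of_ne v.2]
  exact continuous_mk_RP d

theorem toRP_mem_bdX {d : ℕ} {Q : QuadraticForm ℝ (Fin d → ℝ)} {v : Hat d} (hv : v ≠ 0)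
    (h : Qhat Q v = 0) : toRP v ∈ bdX Q := by
  obtain ⟨a, -, ha⟩ := exists_rep_toRP hv
  change Qhat Q (toRP v).rep = 0
  rw [ha, Qhat_smul, h, mul_zero]

theorem mobius_toRP {d : ℕ} {Q : QuadraticForm ℝ (Fin d → ℝ)}
    (f : QuadraticMap.IsometryEquiv (Qhat Q) (Qhat Q)) {v : Hat d} (hv : v ≠ 0) :
    mobius f (toRP v) = toRP (f v) := by
  have hfv : f v ≠ 0 := fun h => hv (f.toLinearEquiv.map_eq_zero_iff.1 h)
  rw [toRP_of_ne hv, toRP_of_ne hfv, mobius, Projectivization.map_mk]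
  rfl

theorem eq_smul_nullLift {d : ℕ} {Q : QuadraticForm ℝ (Fin d → ℝ)} {v : Hat d}
    (h : Qhat Q v = 0) (hv : v.2.2 ≠ 0) : v = v.2.2 • nullLift Q (v.2.2⁻¹ • v.1) := by
  rw [Qhat_apply] at h
  ext
  · simp [nullLift, hv]
  · simp only [nullLift, Prod.smul_fst, Prod.smul_snd, smul_eq_mul, QuadraticMap.map_smul]
    field_simp
    linarith
  · simp [nullLift]

theorem toRP_eq_chart {d : ℕ} {Q : QuadraticForm ℝ (Fin d → ℝ)} {v : Hat d}
    (h : Qhat Q v = 0) (hv : v.2.2 ≠ 0) : toRP v = chart Q (v.2.2⁻¹ • v.1) := by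
  rw [← toRP_nullLift]
  conv_lhs => rw [eq_smul_nullLift h hv]
  exact toRP_smul hv _

theorem chart_injective {d : ℕ} (Q : QuadraticForm ℝ (Fin d → ℝ)) :
    Function.Injective (chart Q) := by
  intro x y h
  rw [← toRP_nullLift, ← toRP_nullLift] at h
  obtain ⟨a, -, ha⟩ := exists_smul_of_toRP_eq (nullLift_ne_zero Q x) (nullLift_ne_zero Q y) h
  have h1 : 1 = a * 1 := congrArg (fun v : Hat d => v.2.2) ha
  have h2 : x = a • y := congrArg (fun v : Hat d => v.1) ha
  rw [h2, show a = 1 by linarith, one_smul]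

theorem snd_snd_ne_zero_of_toRP_eq_chart {d : ℕ} {Q : QuadraticForm ℝ (Fin d → ℝ)} {v : Hat d}
    (hv : v ≠ 0) {z : Fin d → ℝ} (h : toRP v = chart Q z) : v.2.2 ≠ 0 := by
  rw [← toRP_nullLift] at h
  obtain ⟨a, ha, rfl⟩ := exists_smul_of_toRP_eq hv (nullLift_ne_zero Q z) h
  simpa [nullLift] using ha

theorem continuous_chart {d : ℕ} (Q : QuadraticForm ℝ (Fin d → ℝ)) : Continuous (chart Q) := by
  rw [← funext (toRP_nullLift Q)]
  exact (continuousOn_toRP d).comp_continuous (continuous_nullLift Q) (nullLift_ne_zero Q)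

/-! ### The null path, the normalized lift of `f`, and the cells of the image. -/

/-- A null path from `∞` to a vector over `f⁻¹(∞)` along which finitely many functionals that do
not vanish on the admissible set stay positive. -/
theorem exists_null_path {d : ℕ} {Q : QuadraticForm ℝ (Fin d → ℝ)} {X : Set (Fin d → ℝ)}
    {f : QuadraticMap.IsometryEquiv (Qhat Q) (Qhat Q)}
    (hf : mobius f.symm (inftyPt d) ∈ connectedComponentIn (admissible Q X) (inftyPt d))
    {L : Set (Hat d →ₗ[ℝ] ℝ)} (hL : L.Finite) (hL1 : ∀ l ∈ L, l (inftyVec d) = 1)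
    (hLX : ∀ l ∈ L, ∀ q ∈ admissible Q X, l q.rep ≠ 0) :
    ∃ γ : ℝ → Hat d, Continuous γ ∧ γ 0 = inftyVec d ∧
      (∃ k : ℝ, k ≠ 0 ∧ γ 1 = k • f.symm (inftyVec d)) ∧
      ∀ t, Qhat Q (γ t) = 0 ∧ ∀ l ∈ L, 0 < l (γ t) := by
  -- Were `∞` not admissible, its component would be empty by convention, contradicting `hf`.
  have hmem : inftyPt d ∈ admissible Q X := mem_of_mem_of_subset
    (mem_connectedComponentIn (by
      by_contra h
      rw [connectedComponentIn_eq_empty h] at hf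
      exact hf)) (connectedComponentIn_subset _ _)
  obtain ⟨a, ha, hj⟩ := isPreconnected_connectedComponentIn.joinedIn_nullOff (Q := Q) hL
    (fun q hq => ⟨(connectedComponentIn_subset _ _ hq).1, fun l hl =>
      hLX l hl q (connectedComponentIn_subset _ _ hq)⟩) (mem_connectedComponentIn hmem) hf
  have hs : f.symm (inftyVec d) ≠ 0 := fun h =>
    inftyVec_ne_zero d (f.symm.toLinearEquiv.map_eq_zero_iff.1 h)
  obtain ⟨b, hb, hb'⟩ := exists_rep_toRP (inftyVec_ne_zero d)
  obtain ⟨c, hc, hc'⟩ := exists_rep_toRP hs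
  rw [← mobius_toRP f.symm (inftyVec_ne_zero d)] at hc'
  rw [toRP_inftyVec] at hb' hc'
  rw [hb', hc'] at hj
  have hj' := hj.smul_nullOff (inv_ne_zero hb)
  rw [smul_smul, inv_mul_cancel₀ hb, one_smul, smul_smul, smul_smul] at hj'
  obtain ⟨γ, hγ⟩ := hj'
  have hγ' : ∀ t, γ.extend t ∈ nullOff Q L := fun t => by
    obtain ⟨s, hs⟩ : γ.extend t ∈ range γ := by
      rw [← γ.extend_range]
      exact mem_range_self t
    rw [← hs]
    exact hγ s
  refine ⟨γ.extend, γ.continuous_extend, γ.extend_zero, ⟨b⁻¹ * (a * c), ?_, ?_⟩, fun t =>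
    ⟨(hγ' t).1, fun l hl => ?_⟩⟩
  · exact mul_ne_zero (inv_ne_zero hb) (mul_ne_zero ha hc)
  · rw [γ.extend_one]
    simp only [mul_assoc]
  · by_contra! hneg
    have hcont : Continuous fun s => l (γ.extend s) :=
      (LinearMap.continuous_of_finiteDimensional l).comp γ.continuous_extend
    obtain ⟨s, hs⟩ := mem_range_of_exists_le_of_exists_ge (c := 0) hcont ⟨t, hneg⟩
      ⟨0, by rw [γ.extend_zero, hL1 l hl]; exact zero_le_one⟩
    exact (hγ' s).2 l hl hs

/-- A linear similarity `g` of `Q̂` with multiplier `κ > 0` that induces the Möbius transformation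
`f` and takes `p` to `κ ∞`. -/
structure IsNormalizedLift {d : ℕ} (Q : QuadraticForm ℝ (Fin d → ℝ))
    (f : QuadraticMap.IsometryEquiv (Qhat Q) (Qhat Q)) (g : Hat d ≃ₗ[ℝ] Hat d) (κ : ℝ)
    (p : Hat d) : Prop where
  pos : 0 < κ
  map_form : ∀ v, Qhat Q (g v) = κ * Qhat Q v
  map_p : g p = κ • inftyVec d
  toRP_eq : ∀ v, v ≠ 0 → toRP (g v) = mobius f (toRP v)

/-- The scalar `k` at the end of the path may be negative. Multiplying `f` by `k` still gives the
positive multiplier `k ^ 2`, both for the form and for the image of `p`. -/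
theorem exists_isNormalizedLift {d : ℕ} {Q : QuadraticForm ℝ (Fin d → ℝ)}
    (f : QuadraticMap.IsometryEquiv (Qhat Q) (Qhat Q)) {k : ℝ} (hk : k ≠ 0) {p : Hat d}
    (hp : p = k • f.symm (inftyVec d)) :
    ∃ g : Hat d ≃ₗ[ℝ] Hat d, IsNormalizedLift Q f g (k ^ 2) p := by
  refine ⟨f.toLinearEquiv.trans (LinearEquiv.smulOfNeZero ℝ (Hat d) k hk), by positivity,
    fun v => ?_, ?_, fun v hv => ?_⟩
  · change Qhat Q (k • f v) = _
    rw [Qhat_smul, f.map_app]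
  · change k • f p = _
    have h1 : f (k • f.symm (inftyVec d)) = k • f (f.symm (inftyVec d)) :=
      f.toLinearEquiv.map_smul k _
    have h2 : f (f.symm (inftyVec d)) = inftyVec d := f.toLinearEquiv.apply_symm_apply _
    rw [hp, h1, h2, smul_smul, sq]
  · change toRP (k • f v) = _
    rw [toRP_smul hk, mobius_toRP f hv]

/-- The affine point under `g v`. -/
def affinePt {d : ℕ} (g : Hat d ≃ₗ[ℝ] Hat d) (v : Hat d) : Fin d → ℝ := (g v).2.2⁻¹ • (g v).1

namespace IsNormalizedLift

variable {d : ℕ} {Q : QuadraticForm ℝ (Fin d → ℝ)}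
  {f : QuadraticMap.IsometryEquiv (Qhat Q) (Qhat Q)} {g : Hat d ≃ₗ[ℝ] Hat d} {κ : ℝ} {p : Hat d}

theorem polarHat_map (h : IsNormalizedLift Q f g κ p) (u v : Hat d) :
    polarHat Q (g u) (g v) = κ * polarHat Q u v := by
  have h1 := Qhat_add Q (g u) (g v)
  rw [← map_add, h.map_form, h.map_form, h.map_form, Qhat_add] at h1
  linarith

/-- The last coordinate is minus the pairing with `∞`, and `∞` pulls back to `p`. Thus avoiding the
light cones decides which points stay finite, and with which sign. -/
theorem snd_snd (h : IsNormalizedLift Q f g κ p) (v : Hat d) :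
    (g v).2.2 = -polarHat Q v p := by
  have h1 := h.polarHat_map v p
  rw [h.map_p, map_smul, polarHat_inftyVec, smul_eq_mul] at h1
  have := mul_left_cancel₀ h.pos.ne' h1
  linarith

theorem map_eq (h : IsNormalizedLift Q f g κ p) {v : Hat d} (hv : Qhat Q v = 0)
    (hv0 : (g v).2.2 ≠ 0) : g v = (g v).2.2 • nullLift Q (affinePt g v) :=
  eq_smul_nullLift (by rw [h.map_form, hv, mul_zero]) hv0

theorem toRP_map_eq (h : IsNormalizedLift Q f g κ p) {v : Hat d} (hv : Qhat Q v = 0)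
    (hv0 : (g v).2.2 ≠ 0) : toRP (g v) = chart Q (affinePt g v) :=
  toRP_eq_chart (by rw [h.map_form, hv, mul_zero]) hv0

theorem mobius_chart (h : IsNormalizedLift Q f g κ p) {x : Fin d → ℝ}
    (hx : (g (nullLift Q x)).2.2 ≠ 0) :
    mobius f (chart Q x) = chart Q (affinePt g (nullLift Q x)) := by
  rw [← toRP_nullLift, ← h.toRP_eq _ (nullLift_ne_zero Q x),
    h.toRP_map_eq (Qhat_nullLift Q x) hx]

variable {X : Set (Fin d → ℝ)}

theorem imagePts_eq (h : IsNormalizedLift Q f g κ p)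
    (hpos : ∀ x ∈ X, 0 < (g (nullLift Q x)).2.2) {Y : Set (Fin d → ℝ)} (hY : Y ⊆ X) :
    imagePts f Y = (fun x => affinePt g (nullLift Q x)) '' Y := by
  ext z
  constructor
  · rintro ⟨y, hy, hz⟩
    rw [h.mobius_chart (hpos y (hY hy)).ne'] at hz
    exact ⟨y, hy, chart_injective Q hz⟩
  · rintro ⟨y, hy, rfl⟩
    exact ⟨y, hy, h.mobius_chart (hpos y (hY hy)).ne'⟩

theorem spacelikePosition (h : IsNormalizedLift Q f g κ p)
    (hpos : ∀ x ∈ X, 0 < (g (nullLift Q x)).2.2) (hX : SpacelikePosition Q X) :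
    SpacelikePosition Q (imagePts f X) := by
  rw [h.imagePts_eq hpos subset_rfl]
  rintro _ ⟨x, hx, rfl⟩ _ ⟨y, hy, rfl⟩ hne
  have hxy : x ≠ y := by
    rintro rfl
    exact hne rfl
  have h1 := h.polarHat_map (nullLift Q x) (nullLift Q y)
  rw [h.map_eq (Qhat_nullLift Q x) (hpos x hx).ne', h.map_eq (Qhat_nullLift Q y) (hpos y hy).ne',
    map_smul, map_smul, LinearMap.smul_apply, polarHat_nullLift, polarHat_nullLift, smul_eq_mul,
    smul_eq_mul] at h1
  have h2 := mul_pos h.pos (hX x hx y hy hxy)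
  have h3 := mul_pos (hpos y hy) (hpos x hx)
  refine pos_of_mul_pos_right ?_ h3.le
  rw [mul_assoc]
  linarith

/-- Supporting functionals of the lifts of `f(X)` pull back to those of `X`. -/
theorem nonnegOn_imagePts (h : IsNormalizedLift Q f g κ p)
    (hpos : ∀ x ∈ X, 0 < (g (nullLift Q x)).2.2) (l : Hat d →ₗ[ℝ] ℝ) :
    NonnegOn Q (imagePts f X) l ↔ NonnegOn Q X (l ∘ₗ (g : Hat d →ₗ[ℝ] Hat d)) := by
  rw [h.imagePts_eq hpos subset_rfl]
  simp only [NonnegOn, forall_mem_image]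
  refine forall₂_congr fun x hx => ?_
  rw [LinearMap.comp_apply, LinearEquiv.coe_coe, h.map_eq (Qhat_nullLift Q x) (hpos x hx).ne',
    map_smul, smul_eq_mul]
  exact (mul_nonneg_iff_of_pos_left (hpos x hx)).symm

theorem zeros_imagePts (h : IsNormalizedLift Q f g κ p)
    (hpos : ∀ x ∈ X, 0 < (g (nullLift Q x)).2.2) (l : Hat d →ₗ[ℝ] ℝ) :
    {z ∈ imagePts f X | l (nullLift Q z) = 0} =
      imagePts f {x ∈ X | (l ∘ₗ (g : Hat d →ₗ[ℝ] Hat d)) (nullLift Q x) = 0} := by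
  rw [h.imagePts_eq hpos subset_rfl, h.imagePts_eq hpos (fun x hx => hx.1)]
  have key : ∀ x ∈ X, (l ∘ₗ (g : Hat d →ₗ[ℝ] Hat d)) (nullLift Q x) = 0 ↔
      l (nullLift Q (affinePt g (nullLift Q x))) = 0 := by
    intro x hx
    rw [LinearMap.comp_apply, LinearEquiv.coe_coe, h.map_eq (Qhat_nullLift Q x) (hpos x hx).ne',
      map_smul, smul_eq_zero]
    simp [(hpos x hx).ne']
  ext z
  constructor
  · rintro ⟨⟨x, hx, rfl⟩, h0⟩
    exact ⟨x, ⟨hx, (key x hx).2 h0⟩, rfl⟩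
  · rintro ⟨x, ⟨hx, h0⟩, rfl⟩
    exact ⟨⟨x, hx, rfl⟩, (key x hx).1 h0⟩

/-- The combinatorial part: straightened cells are the cells of the Delaunay decomposition of the
image. -/
theorem straightened_cells (h : IsNormalizedLift Q f g κ p) (hfin : X.Finite)
    (hX : SpacelikePosition Q X) (hpos : ∀ x ∈ X, 0 < (g (nullLift Q x)).2.2)
    (h1 : ∀ l, NonnegOn Q X l → 0 < l (inftyVec d) → ∃ l', NonnegOn Q X l' ∧ 0 < l' p ∧
      ∀ x ∈ X, l (nullLift Q x) = 0 → l' (nullLift Q x) = 0)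
    (h2 : ∀ l, NonnegOn Q X l → 0 < l p → ∃ l', NonnegOn Q X l' ∧ 0 < l' (inftyVec d) ∧
      ∀ x ∈ X, l (nullLift Q x) = 0 → l' (nullLift Q x) = 0) :
    {Δ' | ∃ Δ ∈ Del Q X, Δ' = convexHull ℝ (imagePts f (X ∩ Δ))} = Del Q (imagePts f X) := by
  have hfin' : (imagePts f X).Finite := by
    rw [h.imagePts_eq hpos subset_rfl]
    exact hfin.image _
  -- Adding a large multiple of `l'` makes `l` positive at `v` without changing its zeros. Hence it
  -- suffices to compare faces through larger faces.
  have improve : ∀ (l l' : Hat d →ₗ[ℝ] ℝ) (v : Hat d), NonnegOn Q X l → NonnegOn Q X l' →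
      0 < l' v → (∀ x ∈ X, l (nullLift Q x) = 0 → l' (nullLift Q x) = 0) →
      ∃ m, NonnegOn Q X m ∧ 0 < m v ∧
        {x ∈ X | m (nullLift Q x) = 0} = {x ∈ X | l (nullLift Q x) = 0} := by
    intro l l' v hl hl' hv hz
    have hN : 0 ≤ (|l v| + 1) / l' v := by positivity
    refine ⟨l + ((|l v| + 1) / l' v) • l', fun x hx => ?_, ?_, ?_⟩
    · have := hl x hx
      have := hl' x hx
      simp only [LinearMap.add_apply, LinearMap.smul_apply, smul_eq_mul]
      positivity
    · simp only [LinearMap.add_apply, LinearMap.smul_apply, smul_eq_mul]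
      rw [div_mul_cancel₀ _ hv.ne']
      linarith [neg_abs_le (l v)]
    · ext x
      constructor
      · rintro ⟨hx, h0⟩
        refine ⟨hx, le_antisymm ?_ (hl x hx)⟩
        simp only [LinearMap.add_apply, LinearMap.smul_apply, smul_eq_mul] at h0
        have := mul_nonneg hN (hl' x hx)
        linarith
      · rintro ⟨hx, h0⟩
        exact ⟨hx, by simp [h0, hz x hx h0]⟩
  ext Δ'
  rw [mem_Del_iff hfin']
  constructor
  · rintro ⟨Δ, hΔ, rfl⟩
    obtain ⟨l, hl, hl0, ⟨x₀, hx₀⟩, rfl⟩ := (mem_Del_iff hfin _).1 hΔ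
    obtain ⟨l', hl', hl'p, hz⟩ := h1 l hl hl0
    obtain ⟨m, hm, hmp, hmz⟩ := improve l l' p hl hl' hl'p hz
    have hcomp : (m ∘ₗ (g.symm : Hat d →ₗ[ℝ] Hat d)) ∘ₗ (g : Hat d →ₗ[ℝ] Hat d) = m := by
      exact LinearMap.ext fun v => by simp
    refine ⟨m ∘ₗ (g.symm : Hat d →ₗ[ℝ] Hat d), ?_, ?_, ?_, ?_⟩
    · rw [h.nonnegOn_imagePts hpos, hcomp]
      exact hm
    · have : m p = κ * m (g.symm (inftyVec d)) := by
        rw [← smul_eq_mul, ← map_smul, ← map_smul, ← h.map_p, g.symm_apply_apply]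
      rw [this] at hmp
      exact pos_of_mul_pos_right hmp h.pos.le
    · rw [h.zeros_imagePts hpos, hcomp, hmz, h.imagePts_eq hpos (fun x hx => hx.1)]
      exact ⟨_, x₀, hx₀, rfl⟩
    · rw [h.zeros_imagePts hpos, hcomp, hmz, inter_convexHull_zeros hX hl hl0]
  · rintro ⟨l, hl, hl0, hne, rfl⟩
    rw [h.nonnegOn_imagePts hpos] at hl
    have hlp : 0 < (l ∘ₗ (g : Hat d →ₗ[ℝ] Hat d)) p := by
      rw [LinearMap.comp_apply, LinearEquiv.coe_coe, h.map_p, map_smul]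
      exact mul_pos h.pos hl0
    obtain ⟨l', hl', hl'0, hz⟩ := h2 _ hl hlp
    obtain ⟨m, hm, hm0, hmz⟩ := improve _ l' (inftyVec d) hl hl' hl'0 hz
    rw [h.zeros_imagePts hpos, h.imagePts_eq hpos (fun x hx => hx.1)] at hne
    refine ⟨_, (mem_Del_iff hfin _).2 ⟨m, hm, hm0, by rw [hmz]; exact hne.of_image, rfl⟩, ?_⟩
    rw [inter_convexHull_zeros hX hm hm0, hmz, h.zeros_imagePts hpos]

end IsNormalizedLift

/-! ### The isotopies. -/

theorem continuous_Qhat {d : ℕ} (Q : QuadraticForm ℝ (Fin d → ℝ)) : Continuous (Qhat Q) := by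
  rw [show (Qhat Q : Hat d → ℝ) = fun v => Q v.1 - v.2.1 * v.2.2 from funext (Qhat_apply Q)]
  have := continuous_quadraticForm Q
  fun_prop

theorem continuous_polarHat {d : ℕ} (Q : QuadraticForm ℝ (Fin d → ℝ)) :
    Continuous fun v : Hat d × Hat d => polarHat Q v.1 v.2 := by
  have h : ∀ v : Hat d × Hat d,
      polarHat Q v.1 v.2 = Qhat Q (v.1 + v.2) - Qhat Q v.1 - Qhat Q v.2 := fun v => by
    rw [Qhat_add]
    ring
  have := continuous_Qhat Q
  rw [funext h]
  fun_prop

/-- `h` is the height function over `CH(X)` of the lower boundary of the hull of the lifts, which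
is supported by the functionals in `L`. -/
structure IsLowerHeight {d : ℕ} (Q : QuadraticForm ℝ (Fin d → ℝ)) (X : Set (Fin d → ℝ))
    (L : Set (Hat d →ₗ[ℝ] ℝ)) (h : (Fin d → ℝ) → ℝ) : Prop where
  continuous : Continuous h
  nonneg : ∀ l ∈ L, NonnegOn Q X l
  infty : ∀ l ∈ L, l (inftyVec d) = 1
  mem : ∀ y ∈ convexHull ℝ X, ((y, h y, 1) : Hat d) ∈ hatHull Q X
  exists_zero : ∀ y ∈ convexHull ℝ X, ∃ l ∈ L, l (y, h y, 1) = 0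

namespace IsLowerHeight

variable {d : ℕ} {Q : QuadraticForm ℝ (Fin d → ℝ)} {X : Set (Fin d → ℝ)}
  {L : Set (Hat d →ₗ[ℝ] ℝ)} {h : (Fin d → ℝ) → ℝ}

theorem continuous_vec (H : IsLowerHeight Q X L h) :
    Continuous fun y => ((y, h y, 1) : Hat d) :=
  continuous_id.prodMk (H.continuous.prodMk continuous_const)

theorem le_of_mem (H : IsLowerHeight Q X L h) {v : Hat d} (hv : v ∈ hatHull Q X) :
    h v.1 ≤ v.2.1 := by
  have hy : v.1 ∈ convexHull ℝ X := by
    rw [← image_fst_hatHull Q]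
    exact mem_image_of_mem _ hv
  obtain ⟨l, hl, hl0⟩ := H.exists_zero _ hy
  have h1 := functional_nonneg_of_mem_hatHull hv (H.nonneg l hl)
  have h2 : v = (v.1, h v.1, 1) + (v.2.1 - h v.1) • inftyVec d := by
    ext <;> simp [inftyVec, snd_snd_of_mem_hatHull hv]
  rw [h2, map_add, map_smul, hl0, H.infty l hl] at h1
  simpa using h1

/-- The hull lies on or above the graph of `Q` by spacelike position, so a lift cannot be above the
lower boundary. This keeps vertices fixed during the isotopies. -/
theorem vec_vertex (H : IsLowerHeight Q X L h) (hX : SpacelikePosition Q X) {x : Fin d → ℝ}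
    (hx : x ∈ X) : ((x, h x, 1) : Hat d) = nullLift Q x := by
  have h1 : h x ≤ Q x := H.le_of_mem (nullLift_mem_hatHull Q hx)
  have h2 := Qhat_nonpos_of_mem_hatHull hX (H.mem x (subset_convexHull ℝ X hx))
  rw [Qhat_apply] at h2
  simp only [mul_one] at h2
  rw [nullLift, le_antisymm h1 (by linarith)]

theorem image_vec (H : IsLowerHeight Q X L h) {l : Hat d →ₗ[ℝ] ℝ} (hl : NonnegOn Q X l)
    (hl0 : 0 < l (inftyVec d)) :
    (fun y => ((y, h y, 1) : Hat d)) '' convexHull ℝ {x ∈ X | l (nullLift Q x) = 0} =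
      hatHull Q {x ∈ X | l (nullLift Q x) = 0} := by
  have key : ∀ v ∈ hatHull Q {x ∈ X | l (nullLift Q x) = 0}, ((v.1, h v.1, 1) : Hat d) = v := by
    intro v hv
    have hvX : v ∈ hatHull Q X := convexHull_mono (image_mono fun x hx => hx.1) hv
    have hlv : 0 ≤ (-l) v := functional_nonneg_of_mem_hatHull hv fun x hx => by simp [hx.2]
    have hy : v.1 ∈ convexHull ℝ X := by
      rw [← image_fst_hatHull Q]
      exact mem_image_of_mem _ hvX
    have h1 := functional_nonneg_of_mem_hatHull (H.mem _ hy) hl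
    have h2 : v = (v.1, h v.1, 1) + (v.2.1 - h v.1) • inftyVec d := by
      ext <;> simp [inftyVec, snd_snd_of_mem_hatHull hvX]
    rw [LinearMap.neg_apply, h2, map_add, map_smul, smul_eq_mul] at hlv
    have h3 := H.le_of_mem hvX
    have h4 : v.2.1 - h v.1 = 0 := by nlinarith
    rw [h4, zero_smul, add_zero] at h2
    exact h2.symm
  rw [← image_fst_hatHull Q, image_image]
  exact (image_congr key).trans (image_id' _)

end IsLowerHeight

namespace IsNormalizedLift

variable {d : ℕ} {Q : QuadraticForm ℝ (Fin d → ℝ)}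
  {f : QuadraticMap.IsometryEquiv (Qhat Q) (Qhat Q)} {g : Hat d ≃ₗ[ℝ] Hat d} {κ : ℝ} {p : Hat d}
  {X : Set (Fin d → ℝ)} {L : Set (Hat d →ₗ[ℝ] ℝ)} {h : (Fin d → ℝ) → ℝ}

/-- The lower boundary over a cell is mapped onto the straightened image of the cell. -/
theorem image_cell (N : IsNormalizedLift Q f g κ p) (hfin : X.Finite)
    (hX : SpacelikePosition Q X) (hpos : ∀ x ∈ X, 0 < (g (nullLift Q x)).2.2)
    (H : IsLowerHeight Q X L h) {Δ : Set (Fin d → ℝ)} (hΔ : Δ ∈ Del Q X) :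
    (fun y => chart Q (affinePt g (y, h y, 1))) '' Δ =
      chart Q '' convexHull ℝ (imagePts f (X ∩ Δ)) := by
  obtain ⟨l, hl, hl0, -, rfl⟩ := (mem_Del_iff hfin _).1 hΔ
  rw [inter_convexHull_zeros hX hl hl0, N.imagePts_eq hpos fun x hx => hx.1]
  have h1 := image_convexHull_projective
    (LinearMap.fst ℝ (Fin d → ℝ) (ℝ × ℝ) ∘ₗ (g : Hat d →ₗ[ℝ] Hat d))
    (LinearMap.snd ℝ ℝ ℝ ∘ₗ LinearMap.snd ℝ (Fin d → ℝ) (ℝ × ℝ) ∘ₗ (g : Hat d →ₗ[ℝ] Hat d))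
    (S := nullLift Q '' {x ∈ X | l (nullLift Q x) = 0}) (by
      rintro _ ⟨x, hx, rfl⟩
      exact hpos x hx.1)
  change affinePt g '' hatHull Q _ = convexHull ℝ (affinePt g '' _) at h1
  rw [← H.image_vec hl hl0, image_image, image_image] at h1
  rw [← h1, image_image]

theorem snd_snd_pos_of_mem_hatHull (hpos : ∀ x ∈ X, 0 < (g (nullLift Q x)).2.2) {v : Hat d}
    (hv : v ∈ hatHull Q X) : 0 < (g v).2.2 :=
  functional_pos_of_mem_hatHull hv (l := LinearMap.snd ℝ ℝ ℝ ∘ₗ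
    LinearMap.snd ℝ (Fin d → ℝ) (ℝ × ℝ) ∘ₗ (g : Hat d →ₗ[ℝ] Hat d)) hpos

/-- `g p` is vertical, so moving along `p` upstairs is invisible in `ℝ^d`. -/
theorem affinePt_add_smul (N : IsNormalizedLift Q f g κ p) (hp : Qhat Q p = 0) (v : Hat d)
    (a : ℝ) : affinePt g (v + a • p) = affinePt g v := by
  have h2 : (g (v + a • p)).2.2 = (g v).2.2 := by
    rw [N.snd_snd, N.snd_snd, map_add, map_smul, LinearMap.add_apply, LinearMap.smul_apply,
      polarHat_self, hp]
    simp
  have h1 : (g (v + a • p)).1 = (g v).1 := by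
    rw [map_add, map_smul, N.map_p]
    simp [inftyVec]
  rw [affinePt, h1, h2, affinePt]

/-- Projecting the lower boundary of the hull to the null cone along a path of null vectors gives
an isotopy from `f` to its straightening. -/
theorem exists_isotopy_bdX (N : IsNormalizedLift Q f g κ p) (hfin : X.Finite)
    (hX : SpacelikePosition Q X) (H : IsLowerHeight Q X L h) {γ : ℝ → Hat d}
    (hγ : Continuous γ) (hγ0 : γ 0 = inftyVec d) (hγ1 : γ 1 = p) (hγQ : ∀ t, Qhat Q (γ t) = 0)
    (hγL : ∀ t, ∀ l ∈ L, 0 < l (γ t))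
    (hγX : ∀ t, ∀ x ∈ X, polarHat Q (nullLift Q x) (γ t) < 0) :
    ∃ H : ℝ → (Fin d → ℝ) → RP d,
    ContinuousOn (fun p : ℝ × (Fin d → ℝ) => H p.1 p.2) (Icc 0 1 ×ˢ convexHull ℝ X) ∧
    (∀ t ∈ Icc (0 : ℝ) 1, MapsTo (H t) (convexHull ℝ X) (bdX Q) ∧
      InjOn (H t) (convexHull ℝ X)) ∧
    (∀ y ∈ convexHull ℝ X, H 0 y = mobius f (chart Q y)) ∧
    (∀ t ∈ Icc (0 : ℝ) 1, ∀ x ∈ X, H t x = mobius f (chart Q x)) ∧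
    ∀ Δ ∈ Del Q X, H 1 '' Δ = chart Q '' convexHull ℝ (imagePts f (X ∩ Δ)) := by
  have hpos : ∀ x ∈ X, 0 < (g (nullLift Q x)).2.2 := fun x hx => by
    rw [N.snd_snd, ← hγ1]
    linarith [hγX 1 x hx]
  obtain ⟨w, hw⟩ : ∃ w : (Fin d → ℝ) → Hat d, w = fun y => (y, h y, 1) := ⟨_, rfl⟩
  have hwc : Continuous w := by
    rw [hw]
    exact H.continuous_vec
  have hwK : ∀ y ∈ convexHull ℝ X, w y ∈ hatHull Q X := fun y hy => by
    rw [hw]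
    exact H.mem y hy
  have hwX : ∀ x ∈ X, w x = nullLift Q x := fun x hx => by
    rw [hw]
    exact H.vec_vertex hX hx
  have hneg : ∀ t, ∀ y ∈ convexHull ℝ X, polarHat Q (w y) (γ t) < 0 := by
    intro t y hy
    have := functional_pos_of_mem_hatHull (hwK y hy) (l := -(polarHat Q (γ t))) fun x hx => by
      rw [LinearMap.neg_apply, polarHat_comm]
      linarith [hγX t x hx]
    rw [LinearMap.neg_apply, polarHat_comm] at this
    linarith
  -- As `γ t` is null, the form is affine along the line through `w y` in its direction; the
  -- coefficient is the unique root.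
  obtain ⟨u, hu⟩ : ∃ u : ℝ → (Fin d → ℝ) → Hat d, u = fun t y =>
    w y + (-(Qhat Q (w y) / polarHat Q (w y) (γ t))) • γ t := ⟨_, rfl⟩
  have hup : ∀ t y, polarHat Q (u t y) (γ t) = polarHat Q (w y) (γ t) := by
    intro t y
    rw [hu]
    simp only [map_add, map_smul, LinearMap.add_apply, LinearMap.smul_apply, polarHat_self, hγQ,
      mul_zero, smul_zero, add_zero]
  have hu0 : ∀ t, ∀ y ∈ convexHull ℝ X, u t y ≠ 0 := by
    intro t y hy h0
    have := hup t y
    rw [h0, map_zero, LinearMap.zero_apply] at this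
    exact (hneg t y hy).ne this.symm
  have hgu0 : ∀ t, ∀ y ∈ convexHull ℝ X, g (u t y) ≠ 0 := fun t y hy h0 =>
    hu0 t y hy (g.map_eq_zero_iff.1 h0)
  have huQ : ∀ t, ∀ y ∈ convexHull ℝ X, Qhat Q (u t y) = 0 := by
    intro t y hy
    rw [hu]
    simp only [Qhat_add, Qhat_smul, hγQ, map_smul, smul_eq_mul, neg_mul,
      div_mul_cancel₀ _ (hneg t y hy).ne]
    ring
  have huX : ∀ t, ∀ x ∈ X, u t x = nullLift Q x := by
    intro t x hx
    rw [hu]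
    simp [hwX x hx, Qhat_nullLift]
  refine ⟨fun t y => toRP (g (u t y)), ?_, fun t _ => ⟨fun y hy => ?_, ?_⟩, fun y hy => ?_,
    fun t _ x hx => ?_, fun Δ hΔ => ?_⟩
  · refine (continuousOn_toRP d).comp (t := {v | v ≠ 0}) ?_ fun q hq => hgu0 q.1 q.2 hq.2
    refine (LinearMap.continuous_of_finiteDimensional
      (g : Hat d →ₗ[ℝ] Hat d)).comp_continuousOn ?_
    rw [hu]
    have h1 : Continuous fun q : ℝ × (Fin d → ℝ) => polarHat Q (w q.2) (γ q.1) :=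
      (continuous_polarHat Q).comp ((hwc.comp continuous_snd).prodMk (hγ.comp continuous_fst))
    have h2 : Continuous fun q : ℝ × (Fin d → ℝ) => Qhat Q (w q.2) :=
      (continuous_Qhat Q).comp (hwc.comp continuous_snd)
    refine (hwc.comp continuous_snd).continuousOn.add (ContinuousOn.smul (ContinuousOn.neg
      (h2.continuousOn.div h1.continuousOn fun q hq => (hneg q.1 q.2 hq.2).ne))
      (hγ.comp continuous_fst).continuousOn)
  · exact toRP_mem_bdX (hgu0 t y hy) (by rw [N.map_form, huQ t y hy, mul_zero])
  -- The functional of `L` supporting the lower boundary at `w y` is nonnegative at `w y'` and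
  -- positive at `γ t`. Exchanging `y` and `y'` then forces `b = 0`.
  · have key : ∀ y ∈ convexHull ℝ X, ∀ y' ∈ convexHull ℝ X, ∀ a b : ℝ, 0 < a →
        w y = a • w y' + b • γ t → b ≤ 0 := by
      intro y hy y' hy' a b ha hab
      obtain ⟨l, hl, hl0⟩ := H.exists_zero y hy
      have h1 : l (w y) = 0 := by
        rw [hw]
        exact hl0
      have h2 := functional_nonneg_of_mem_hatHull (hwK y' hy') (H.nonneg l hl)
      rw [hab, map_add, map_smul, map_smul, smul_eq_mul, smul_eq_mul] at h1
      by_contra! hb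
      linarith [mul_nonneg ha.le h2, mul_pos hb (hγL t l hl)]
    intro y hy y' hy' heq
    obtain ⟨a, -, ha⟩ := exists_smul_of_toRP_eq (hgu0 t y hy) (hgu0 t y' hy') heq
    rw [← map_smul] at ha
    have ha' := g.injective ha
    have hpol := hup t y
    rw [ha', map_smul, LinearMap.smul_apply, hup, smul_eq_mul] at hpol
    have hapos : 0 < a := by
      have h1 := hneg t y hy
      have h2 := hneg t y' hy'
      by_contra! hcon
      nlinarith
    obtain ⟨b, hb⟩ : ∃ b : ℝ, w y = a • w y' + b • γ t := by
      rw [hu] at ha'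
      refine ⟨Qhat Q (w y) / polarHat Q (w y) (γ t) -
        a * (Qhat Q (w y') / polarHat Q (w y') (γ t)), ?_⟩
      rw [← sub_eq_zero] at ha' ⊢
      rw [← ha']
      module
    have hb1 := key y hy y' hy' a b hapos hb
    have hb2 := key y' hy' y hy a⁻¹ (-(a⁻¹ * b)) (by positivity) (by
      rw [hb, smul_add, smul_smul, smul_smul, inv_mul_cancel₀ hapos.ne']
      module)
    have hb0 : b = 0 := by
      have : 0 < a⁻¹ := by positivity
      by_contra hne
      have : b < 0 := lt_of_le_of_ne hb1 hne
      nlinarith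
    rw [hb0, zero_smul, add_zero, hw] at hb
    have h1 : (1 : ℝ) = a * 1 := congrArg (fun v : Hat d => v.2.2) hb
    have h2 : y = a • y' := congrArg (fun v : Hat d => v.1) hb
    rw [h2, show a = 1 by linarith, one_smul]
  · have hu0y : u 0 y = nullLift Q y := by
      have h1 := nullLift_eq_of_mem_hatHull (hwK y hy)
      have h2 : (w y).1 = y := by rw [hw]
      rw [h2] at h1
      have h3 : polarHat Q (w y) (inftyVec d) = -1 := by
        rw [polarHat_inftyVec, snd_snd_of_mem_hatHull (hwK y hy)]
      rw [hu]
      simp only [hγ0, h3]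
      rw [← sub_eq_zero, ← neg_eq_zero, ← sub_eq_zero.2 h1]
      module
    simp only [hu0y]
    rw [N.toRP_eq _ (nullLift_ne_zero Q y), toRP_nullLift]
  · simp only [huX t x hx]
    rw [N.toRP_eq _ (nullLift_ne_zero Q x), toRP_nullLift]
  · rw [← N.image_cell hfin hX hpos H hΔ]
    have hsub : Δ ⊆ convexHull ℝ X := by
      obtain ⟨l, -, -, -, rfl⟩ := (mem_Del_iff hfin _).1 hΔ
      exact convexHull_mono fun x hx => hx.1
    refine image_congr fun y hy => ?_
    have hy := hsub hy
    have hc : (g (u 1 y)).2.2 ≠ 0 := by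
      rw [N.snd_snd, ← hγ1, hup]
      exact (neg_pos.2 (hneg 1 y hy)).ne'
    change toRP (g (u 1 y)) = _
    rw [N.toRP_map_eq (huQ 1 y hy) hc, hu]
    simp only [hγ1]
    rw [N.affinePt_add_smul (hγ1 ▸ hγQ 1), hw]

/-- If `f` is finite on `CH(X)`, lowering the hull vertically to the graph of `Q` gives an isotopy
within `ℝ^d`. -/
theorem exists_isotopy_chart (N : IsNormalizedLift Q f g κ p) (hfin : X.Finite)
    (hX : SpacelikePosition Q X) (H : IsLowerHeight Q X L h)
    (hp : Qhat Q p = 0) (hLp : ∀ l ∈ L, 0 < l p)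
    (hpos : ∀ y ∈ convexHull ℝ X, 0 < (g (nullLift Q y)).2.2) :
    ∃ H : ℝ → (Fin d → ℝ) → RP d,
    ContinuousOn (fun p : ℝ × (Fin d → ℝ) => H p.1 p.2) (Icc 0 1 ×ˢ convexHull ℝ X) ∧
    (∀ t ∈ Icc (0 : ℝ) 1, MapsTo (H t) (convexHull ℝ X) (range (chart Q)) ∧
      InjOn (H t) (convexHull ℝ X)) ∧
    (∀ y ∈ convexHull ℝ X, H 0 y = mobius f (chart Q y)) ∧
    (∀ t ∈ Icc (0 : ℝ) 1, ∀ x ∈ X, H t x = mobius f (chart Q x)) ∧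
    ∀ Δ ∈ Del Q X, H 1 '' Δ = chart Q '' convexHull ℝ (imagePts f (X ∩ Δ)) := by
  have hposX : ∀ x ∈ X, 0 < (g (nullLift Q x)).2.2 := fun x hx =>
    hpos x (subset_convexHull ℝ X hx)
  obtain ⟨δ, hδ⟩ : ∃ δ : (Fin d → ℝ) → ℝ, δ = fun y => h y - Q y := ⟨_, rfl⟩
  have hδc : Continuous δ := by
    rw [hδ]
    exact H.continuous.sub (continuous_quadraticForm Q)
  obtain ⟨u, hu⟩ : ∃ u : ℝ → (Fin d → ℝ) → Hat d, u = fun t y =>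
    nullLift Q y + (t * δ y) • inftyVec d := ⟨_, rfl⟩
  have hu1 : ∀ y, u 1 y = (y, h y, 1) := by
    intro y
    rw [hu, hδ]
    ext <;> simp [nullLift, inftyVec]
  have hu0 : ∀ y, u 0 y = nullLift Q y := by
    intro y
    rw [hu]
    simp
  have hu22 : ∀ t y, (u t y).2.2 = 1 := by
    intro t y
    rw [hu]
    simp [nullLift, inftyVec]
  have hulin : ∀ t y, u t y = (1 - t) • u 0 y + t • u 1 y := by
    intro t y
    rw [hu]
    module
  have hgpos : ∀ t ∈ Icc (0 : ℝ) 1, ∀ y ∈ convexHull ℝ X, 0 < (g (u t y)).2.2 := by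
    intro t ht y hy
    have h0 := hpos y hy
    have h1 := snd_snd_pos_of_mem_hatHull hposX (H.mem y hy)
    rw [hulin, hu0, hu1]
    simp only [map_add, map_smul, Prod.snd_add, Prod.smul_snd, smul_eq_mul]
    rcases ht.1.eq_or_lt with h | h
    · rw [← h]
      simpa using h0
    · have := mul_nonneg (sub_nonneg.2 ht.2) h0.le
      have := mul_pos h h1
      linarith
  have hδX : ∀ x ∈ X, δ x = 0 := by
    intro x hx
    have h1 : h x = Q x := congrArg (fun v : Hat d => v.2.1) (H.vec_vertex hX hx)
    rw [hδ]
    simp [h1]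
  have hgc := LinearMap.continuous_of_finiteDimensional (g : Hat d →ₗ[ℝ] Hat d)
  refine ⟨fun t y => chart Q (affinePt g (u t y)), ?_, fun t ht => ⟨fun y hy => ⟨_, rfl⟩, ?_⟩,
    fun y hy => ?_, fun t _ x hx => ?_, fun Δ hΔ => ?_⟩
  · refine (continuous_chart Q).comp_continuousOn ?_
    have huc : Continuous fun q : ℝ × (Fin d → ℝ) => g (u q.1 q.2) := by
      refine hgc.comp ?_
      rw [hu]
      have := continuous_nullLift Q
      fun_prop
    exact ContinuousOn.smul (ContinuousOn.inv₀ huc.snd.snd.continuousOn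
      fun q hq => (hgpos q.1 hq.1 q.2 hq.2).ne') huc.fst.continuousOn
  -- If `b > 0`, the quadratic form gives `t * (δ y - a * δ y') > 0`, whereas the functional
  -- supporting at `y` gives `(1 - t) * (δ y - a * δ y') < 0`. These are incompatible for `t` in
  -- `[0, 1]`.
  · have key : ∀ y ∈ convexHull ℝ X, ∀ y' ∈ convexHull ℝ X, ∀ a b : ℝ, 0 < a →
        u t y = a • u t y' + b • p → b ≤ 0 := by
      intro y hy y' hy' a b ha hab
      by_contra! hb
      have hQu : ∀ y, Qhat Q (u t y) = -(t * δ y) := by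
        intro y
        rw [hu]
        simp only [Qhat_add, Qhat_smul, Qhat_nullLift, Qhat_inftyVec, map_smul, polarHat_inftyVec]
        simp [nullLift]
      have h1 := congrArg (Qhat Q) hab
      rw [Qhat_add, Qhat_smul, Qhat_smul, hp, hQu, hQu, map_smul, map_smul, LinearMap.smul_apply,
        smul_eq_mul, smul_eq_mul] at h1
      have h2 : (1 : ℝ) = a + b * p.2.2 := by
        have := congrArg (fun v : Hat d => v.2.2) hab
        simpa [hu22] using this
      have h3 : polarHat Q (u t y') p = polarHat Q (nullLift Q y') p - t * δ y' * p.2.2 := by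
        rw [hu]
        simp only [map_add, map_smul, LinearMap.add_apply, LinearMap.smul_apply, smul_eq_mul]
        rw [polarHat_comm Q (inftyVec d), polarHat_inftyVec]
        ring
      have h4 : 0 < -polarHat Q (nullLift Q y') p := by
        rw [← N.snd_snd]
        exact hpos y' hy'
      rw [h3] at h1
      have h5 : t * δ y = a * (t * δ y') + a * b * (-polarHat Q (nullLift Q y') p) := by
        linear_combination -h1 - a * (t * δ y') * h2
      obtain ⟨l, hl, hl0⟩ := H.exists_zero y hy
      rw [← hu1] at hl0
      have h6 : ∀ y, l (u t y) = l (u 1 y) - (1 - t) * δ y := by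
        intro y
        rw [hu]
        simp only [map_add, map_smul, H.infty l hl, smul_eq_mul]
        ring
      have h7 := congrArg l hab
      rw [map_add, map_smul, map_smul, h6, h6, hl0, smul_eq_mul, smul_eq_mul] at h7
      have h8 : 0 ≤ l (u 1 y') := by
        rw [hu1]
        exact functional_nonneg_of_mem_hatHull (H.mem y' hy') (H.nonneg l hl)
      have h9 := mul_pos hb (hLp l hl)
      have h10 := mul_nonneg ha.le h8
      have h11 := mul_pos (mul_pos ha hb) h4
      have h12 : (1 - t) * (δ y - a * δ y') < 0 := by nlinarith
      have h13 : 0 < t * (δ y - a * δ y') := by nlinarith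
      have h14 : 0 < δ y - a * δ y' := pos_of_mul_pos_right h13 ht.1
      nlinarith [mul_nonneg (sub_nonneg.2 ht.2) h14.le]
    intro y hy y' hy' heq
    have heq' : affinePt g (u t y) = affinePt g (u t y') := chart_injective Q heq
    have hc := hgpos t ht y hy
    have hc' := hgpos t ht y' hy'
    set a := (g (u t y)).2.2 / (g (u t y')).2.2 with ha
    have hapos : 0 < a := div_pos hc hc'
    -- Equal affine points mean that, after scaling by `a`, the images under `g` differ only
    -- vertically, that is, by a multiple of `g p`.
    obtain ⟨b, hb⟩ : ∃ b : ℝ, u t y = a • u t y' + b • p := by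
      refine ⟨((g (u t y)).2.1 - a * (g (u t y')).2.1) / κ, g.injective ?_⟩
      rw [map_add, map_smul, map_smul, N.map_p, smul_smul, div_mul_cancel₀ _ N.pos.ne']
      have hfst : (g (u t y)).1 = a • (g (u t y')).1 := by
        rw [ha, div_eq_mul_inv, mul_smul]
        change _ = _ • affinePt g (u t y')
        rw [← heq', affinePt, smul_smul, mul_inv_cancel₀ hc.ne', one_smul]
      refine Prod.ext ?_ (Prod.ext ?_ ?_)
      · rw [hfst]
        simp [inftyVec]
      · simp [inftyVec]
      · simp [inftyVec, ha, hc'.ne']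
    have hb1 := key y hy y' hy' a b hapos hb
    have hb2 := key y' hy' y hy a⁻¹ (-(a⁻¹ * b)) (by positivity) (by
      rw [hb, smul_add, smul_smul, smul_smul, inv_mul_cancel₀ hapos.ne']
      module)
    have hb0 : b = 0 := by
      have : 0 < a⁻¹ := by positivity
      by_contra hne
      have : b < 0 := lt_of_le_of_ne hb1 hne
      nlinarith
    rw [hb0, zero_smul, add_zero] at hb
    have h1 : (1 : ℝ) = a := by
      have := congrArg (fun v : Hat d => v.2.2) hb
      simpa [hu22] using this
    rw [← h1, one_smul, hu] at hb
    have h2 := congrArg (fun v : Hat d => v.1) hb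
    simpa [nullLift, inftyVec] using h2
  · simp only [hu0]
    exact (N.mobius_chart (hpos y hy).ne').symm
  · have : u t x = nullLift Q x := by
      rw [hu]
      simp [hδX x hx]
    simp only [this]
    exact (N.mobius_chart (hposX x hx).ne').symm
  · rw [← N.image_cell hfin hX hposX H hΔ]
    simp only [hu1]

end IsNormalizedLift

end

/-! ### Assembly. -/

theorem mainTheorem5 (d : ℕ) (Q : QuadraticForm ℝ (Fin d → ℝ)) (X : Set (Fin d → ℝ))
    (hfin : X.Finite) (hspace : SpacelikePosition Q X) (hgen : GeneralLinearPosition X)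
    (f : QuadraticMap.IsometryEquiv (Qhat Q) (Qhat Q))
    (hf : mobius f.symm (inftyPt d) ∈ connectedComponentIn (admissible Q X) (inftyPt d)) :
    (∀ x ∈ X, ∃ z, mobius f (chart Q x) = chart Q z) ∧
    SpacelikePosition Q (imagePts f X) ∧
    StraightensIn Q f X (bdX Q) ∧
    ((∀ y ∈ convexHull ℝ X, ∃ z, mobius f (chart Q y) = chart Q z) →
      StraightensIn Q f X (range (chart Q))) := by
  rcases X.eq_empty_or_nonempty with rfl | hne
  · have hI : imagePts f (∅ : Set (Fin d → ℝ)) = ∅ := by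
      ext
      simp [imagePts]
    have hD : Del Q (∅ : Set (Fin d → ℝ)) = ∅ := by
      ext Δ
      simp [mem_Del_iff finite_empty]
    have hS : ∀ M, StraightensIn Q f ∅ M := fun M =>
      ⟨by rw [hI, hD]; simp, fun _ y => mobius f (chart Q y), by simp,
        by simp [mapsTo_empty], by simp, by simp,
        by simp [hD]⟩
    exact ⟨by simp, by simp [hI, SpacelikePosition], hS _, fun _ => hS _⟩
  obtain ⟨L, M, hL, hM, hLe, hMf, hLP, hMP⟩ := exists_sphere_families Q hfin hgen
  have hL1 : ∀ l ∈ L, NonnegOn Q X l ∧ l (inftyVec d) = 1 := by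
    intro l hl
    obtain ⟨hnn, φ, D, rfl, -⟩ := hLe l hl
    exact ⟨hnn, sphereFunctional_inftyVec φ D⟩
  -- The path must avoid the empty spheres, the full spheres and the light cones; the pairings carry
  -- a minus sign so that they too equal 1 at `∞`.
  obtain ⟨γ, hγ, hγ0, ⟨k, hk, hγ1⟩, hγQ⟩ := exists_null_path hf
    (L := L ∪ M ∪ (fun x => -(polarHat Q (nullLift Q x))) '' X)
    ((hL.union hM).union (hfin.image _)) (by
      rintro l ((hl | hl) | ⟨x, hx, rfl⟩)
      · exact (hL1 l hl).2
      · obtain ⟨φ, D, rfl, -⟩ := hMf l hl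
        exact sphereFunctional_inftyVec φ D
      · rw [LinearMap.neg_apply, polarHat_inftyVec]
        simp [nullLift]) (by
      have key : ∀ φ D, (IsEmptySphere Q X φ D ∨ IsFullSphere Q X φ D) →
          ∀ q ∈ admissible Q X, sphereFunctional φ D q.rep ≠ 0 := by
        intro φ D hS q hq h0
        rw [sphereFunctional_apply] at h0
        exact hq.2 (Or.inl ⟨φ, D, hS, hq.1, by linarith⟩)
      rintro l ((hl | hl) | ⟨x, hx, rfl⟩) q hq
      · obtain ⟨-, φ, D, rfl, hS⟩ := hLe l hl
        exact key φ D (Or.inl hS) q hq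
      · obtain ⟨φ, D, rfl, hS⟩ := hMf l hl
        exact key φ D (Or.inr hS) q hq
      · intro h0
        refine hq.2 (Or.inr (mem_iUnion₂.2 ⟨x, hx, hq.1, ?_⟩))
        change polarHat Q (chart Q x).rep q.rep = 0
        obtain ⟨a, -, ha⟩ := exists_rep_toRP (nullLift_ne_zero Q x)
        rw [← toRP_nullLift, ha, map_smul, LinearMap.smul_apply]
        rw [LinearMap.neg_apply, neg_eq_zero] at h0
        rw [h0, smul_zero])
  obtain ⟨g, N⟩ := exists_isNormalizedLift f hk hγ1
  have hγL : ∀ t, ∀ l ∈ L, 0 < l (γ t) := fun t l hl => (hγQ t).2 l (Or.inl (Or.inl hl))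
  have hγM : ∀ t, ∀ l ∈ M, 0 < l (γ t) := fun t l hl => (hγQ t).2 l (Or.inl (Or.inr hl))
  have hγX : ∀ t, ∀ x ∈ X, polarHat Q (nullLift Q x) (γ t) < 0 := fun t x hx => by
    have := (hγQ t).2 _ (Or.inr ⟨x, hx, rfl⟩)
    rw [LinearMap.neg_apply] at this
    linarith
  have hpos : ∀ x ∈ X, 0 < (g (nullLift Q x)).2.2 := fun x hx => by
    rw [N.snd_snd]
    linarith [hγX 1 x hx]
  obtain ⟨h, hhc, hh⟩ := exists_lower_height hfin hne hL hL1 fun l hl hl0 w hw => by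
    obtain ⟨l', hl', -, h⟩ := hLP l hl hl0 w hw
    exact ⟨l', hl', h⟩
  have H : IsLowerHeight Q X L h := ⟨hhc, fun l hl => (hL1 l hl).1, fun l hl => (hL1 l hl).2,
    fun y hy => (hh y hy).1, fun y hy => (hh y hy).2⟩
  have hcells := N.straightened_cells hfin hspace hpos (fun l hl hl0 => by
    obtain ⟨l', hl', hz, -⟩ := hLP l hl hl0 0 (by simp)
    exact ⟨l', (hL1 l' hl').1, hγL 1 l' hl', hz⟩) fun l hl hl0 => hMP l _ hl hl0 (hγM 1)
  refine ⟨fun x hx => ⟨_, N.mobius_chart (hpos x hx).ne'⟩, N.spacelikePosition hpos hspace,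
    ⟨hcells, N.exists_isotopy_bdX hfin hspace H hγ hγ0 rfl (fun t => (hγQ t).1) hγL hγX⟩,
    fun hfinite => ⟨hcells, N.exists_isotopy_chart hfin hspace H (hγQ 1).1 (hγL 1) ?_⟩⟩
  have hne0 : ∀ y ∈ convexHull ℝ X, (g (nullLift Q y)).2.2 ≠ 0 := by
    intro y hy
    obtain ⟨z, hz⟩ := hfinite y hy
    rw [← toRP_nullLift, ← N.toRP_eq _ (nullLift_ne_zero Q y)] at hz
    exact snd_snd_ne_zero_of_toRP_eq_chart
      (fun h0 => nullLift_ne_zero Q y (g.map_eq_zero_iff.1 h0)) hz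
  intro y hy
  -- The last coordinate has no zero on the connected set `CH(X)` and is positive at a vertex, hence
  -- is positive throughout.
  by_contra! hcon
  obtain ⟨x, hx⟩ := hne
  have hcont : Continuous fun y => (g (nullLift Q y)).2.2 :=
    ((LinearMap.continuous_of_finiteDimensional (g : Hat d →ₗ[ℝ] Hat d)).comp
      (continuous_nullLift Q)).snd.snd
  obtain ⟨z, hz, hz0⟩ := (convex_convexHull ℝ X).isPreconnected.intermediate_value hy
    (subset_convexHull ℝ X hx) hcont.continuousOn ⟨hcon, (hpos x hx).le⟩
  exact hne0 z hz hz0
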